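/- A translation surface $(S,\alpha)$ is a connected Riemann surface $S$ with a holomorphic $1$-form $\alpha\not\equiv 0$; its local coordinates are $q\mapsto\int_p^q\alpha$, and $A\in SL(2,\mathbb R)$ acts by postcomposing these coordinates with the real-linear map $A$ of $\mathbb C=\mathbb R^2$. Two such surfaces are translation equivalent if there is a homeomorphism between them that is a translation in local coordinates. Let $V(S,\alpha)=\{A\in SL(2,\mathbb R): A(S,\alpha)\text{ is translation equivalent to }(S,\alpha)\}$ and $g^t=\mathrm{diag}(e^{-t},e^t)$. Let $d\ge 2$, let $\Pi_d$ be the permutation group of $\{1,\dots,d\}$, let $G\subset\Pi_d$ be a subgroup, and fix $s_0\in S$. Every $h\in\mathrm{Hom}(\pi_1(S,s_0),G)$ determines a $d$-fold cover $(\tilde S_h,\tilde\alpha_h)$ of $(S,\alpha)$ (possibly disconnected) with monodromy $h$ and the lifted translation structure. $\mathrm{Cov}_G(S,\alpha)$ is the set of these covers up to translation equivalence, with the quotient topology from $\mathrm{Hom}(\pi_1(S,s_0),G)$ (which has the topology of pointwise convergence, $G$ being discrete). $\tilde{\mathcal O}_G(S,\alpha)$ is the set of all surfaces $A(\tilde S,\tilde\alpha)$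 with $A\in SL(2,\mathbb R)$ and $(\tilde S,\tilde\alpha)\in\mathrm{Cov}_G(S,\alpha)$, up to translation equivalence, as a topological quotient of $SL(2,\mathbb R)\times\mathrm{Cov}_G(S,\alpha)$. If $S$ has infinite topological type (that is, $\pi_1(S,s_0)$ is not finitely generated), then $\pi_1(S,s_0)$ is a free group of countably infinite rank; choosing the images of the elements of a free generating set independently and uniformly in $G$ defines the product measure on $\mathrm{Hom}(\pi_1(S,s_0),G)$, and $m_G$ is its image on $\mathrm{Cov}_G(S,\alpha)$. Theorem. Let $(S,\alpha)$ be a translation surface of finite area and infinite topological type, and suppose that its Teichmüller trajectory is non-divergent: there are $t_n\to+\infty$ for which the cosets $g^{t_n}V(S,\alpha)$ converge in $SL(2,\mathbb R)/V(S,\alpha)$. Suppose that $G$ acts transitively on $\{1,\dots,d\}$. Then for every choice of the free generating set in the definition of $m_G$, $m_G$-almost every cover $(\tilde S,\tilde\alpha)\in\mathrm{Cov}_G(S,\alpha)$ has a Teichmüller trajectory with a connected accumulation point: there are $t_n\to+\infty$ such that $g^{t_n}(\tilde S,\tilde\alpha)$ converges in $\tilde{\mathcal O}_G(S,\alpha)$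 to a point that represents a connected surface. -/

import Mathlib

open Set Filter Topology MeasureTheory

noncomputable section

/-! ### The linear action of `SL(2, ℝ)` on the plane -/

/-- The group `SL(2, ℝ)`. -/
abbrev SL2R : Type := Matrix.SpecialLinearGroup (Fin 2) ℝ

namespace SL2R

/-- The real-linear map `x + i y ↦ (a₁₁ x + a₁₂ y) + i (a₂₁ x + a₂₂ y)` of `ℂ`. -/
def toPlane (A : SL2R) (z : ℂ) : ℂ :=
  ⟨A.1 0 0 * z.re + A.1 0 1 * z.im, A.1 1 0 * z.re + A.1 1 1 * z.im⟩

theorem toPlane_one (z : ℂ) : toPlane 1 z = z := by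
  apply Complex.ext <;> simp [toPlane]

theorem toPlane_mul (A B : SL2R) (z : ℂ) : toPlane (A * B) z = toPlane A (toPlane B z) := by
  apply Complex.ext <;> simp [toPlane, Matrix.mul_apply, Fin.sum_univ_two] <;> ring

theorem toPlane_sub (A : SL2R) (z w : ℂ) : toPlane A (z - w) = toPlane A z - toPlane A w := by
  apply Complex.ext <;> simp [toPlane] <;> ring

/-- The matrices `g^t(x, y) = (e^{-t} x, e^t y)`. -/
def teich (t : ℝ) : SL2R :=
  ⟨!![Real.exp (-t), 0; 0, Real.exp t], by
    rw [Matrix.det_fin_two_of, ← Real.exp_add]; simp⟩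

/-! Postcomposing the branched coordinate `z ↦ z ^ n` with a matrix of `SL(2, ℝ)` gives again
the `n`-th power of a homeomorphism. -/

/-- The bounded factor `(z̄ / z) ^ n`. -/
def phase (n : ℕ) (z : ℂ) : ℂ := (starRingEnd ℂ z / z) ^ n

theorem norm_phase_le (n : ℕ) (z : ℂ) : ‖phase n z‖ ≤ 1 := by
  rw [phase, norm_pow, norm_div, RCLike.norm_conj]
  exact pow_le_one₀ (by positivity) (div_self_le_one _)

/-- An explicit `n`-th root of `z ↦ a zⁿ + b z̄ⁿ`. -/
def rootMap (n : ℕ) (a b : ℂ) (z : ℂ) : ℂ :=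
  a ^ (1 / (n : ℂ)) * z * (1 + b / a * phase n z) ^ (1 / (n : ℂ))

theorem one_add_mem_slitPlane {n : ℕ} {a b : ℂ} (hab : ‖b‖ < ‖a‖) (z : ℂ) :
    1 + b / a * phase n z ∈ Complex.slitPlane := by
  apply Complex.mem_slitPlane_of_norm_lt_one
  have ha : 0 < ‖a‖ := lt_of_le_of_lt (norm_nonneg _) hab
  rw [norm_mul, norm_div]
  calc ‖b‖ / ‖a‖ * ‖phase n z‖ ≤ ‖b‖ / ‖a‖ * 1 := by
        gcongr; exact norm_phase_le n z
    _ < 1 := by rw [mul_one, div_lt_one ha]; exact hab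

theorem rootMap_pow {n : ℕ} (hn : n ≠ 0) {a b : ℂ} (hab : ‖b‖ < ‖a‖) (z : ℂ) :
    rootMap n a b z ^ n = a * z ^ n + b * starRingEnd ℂ z ^ n := by
  have ha : a ≠ 0 := norm_pos_iff.1 (lt_of_le_of_lt (norm_nonneg _) hab)
  rw [rootMap, mul_pow, mul_pow, one_div, Complex.cpow_nat_inv_pow _ hn,
    Complex.cpow_nat_inv_pow _ hn]
  rcases eq_or_ne z 0 with rfl | hz
  · simp [hn]
  · rw [phase, div_pow]; field_simp

theorem rootMap_zero (n : ℕ) (a b : ℂ) : rootMap n a b 0 = 0 := by simp [rootMap]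

theorem continuous_rootMap {n : ℕ} {a b : ℂ} (hab : ‖b‖ < ‖a‖) :
    Continuous (rootMap n a b) := by
  rw [continuous_iff_continuousAt]
  intro z
  rcases eq_or_ne z 0 with rfl | hz
  · rw [ContinuousAt, rootMap_zero]
    rcases eq_or_ne n 0 with rfl | hn
    · have : rootMap 0 a b = fun z => z := by ext z; simp [rootMap]
      rw [this]; exact tendsto_id
    have key : Tendsto (fun z : ℂ => ‖a * z ^ n + b * starRingEnd ℂ z ^ n‖) (𝓝 0) (𝓝 0) := by
      have : Continuous fun z : ℂ => ‖a * z ^ n + b * starRingEnd ℂ z ^ n‖ := by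
        have := Complex.continuous_conj
        fun_prop
      simpa [hn] using this.tendsto 0
    have h2 : Tendsto (fun z : ℂ => ‖rootMap n a b z‖ ^ n) (𝓝 0) (𝓝 0) := by
      simpa only [← norm_pow, rootMap_pow hn hab] using key
    have h3 := h2.rpow_const (p := 1 / (n : ℝ)) (Or.inr (by positivity))
    rw [Real.zero_rpow (by positivity)] at h3
    rw [tendsto_zero_iff_norm_tendsto_zero]
    refine h3.congr fun z => ?_
    rw [one_div, Real.pow_rpow_inv_natCast (norm_nonneg _) hn]
  · have h1 : ContinuousAt (phase n) z := by
      unfold phase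
      exact (Complex.continuous_conj.continuousAt.div continuousAt_id hz).pow n
    have h2 : ContinuousAt (fun z => 1 + b / a * phase n z) z :=
      continuousAt_const.add (continuousAt_const.mul h1)
    exact (continuousAt_const.mul continuousAt_id).mul
      (h2.cpow continuousAt_const (one_add_mem_slitPlane hab z))

theorem eq_mul_of_pow_eq {n : ℕ} (hn : n ≠ 0) {H : ℂ → ℂ} (hH : Continuous H)
    (h : ∀ z, H z ^ n = z ^ n) : ∃ ζ : ℂ, ζ ≠ 0 ∧ ∀ z, H z = ζ * z := by
  have hconn : IsPreconnected ({0}ᶜ : Set ℂ) :=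
    (isConnected_compl_singleton_of_one_lt_rank (by simp) 0).isPreconnected
  have hfin : Set.Finite {w : ℂ | w ^ n = 1} :=
    (Polynomial.nthRoots n (1 : ℂ)).toFinset.finite_toSet.subset fun w hw => by
      simpa [Polynomial.mem_nthRoots (Nat.pos_of_ne_zero hn)] using hw
  have hq : ∀ z : ℂ, z ≠ 0 → (H z / z) ^ n = 1 := fun z hz => by
    rw [div_pow, h, div_self (pow_ne_zero n hz)]
  refine ⟨H 1 / 1, fun h0 => ?_, fun z => ?_⟩
  · have := hq 1 one_ne_zero
    rw [h0, zero_pow hn] at this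
    exact zero_ne_one this
  · rcases eq_or_ne z 0 with rfl | hz
    · have := h 0
      rw [zero_pow hn] at this
      simpa using pow_eq_zero_iff hn |>.1 this
    · have hc : ContinuousOn (fun z => H z / z) ({0}ᶜ : Set ℂ) :=
        hH.continuousOn.div continuousOn_id fun z hz => hz
      have := hconn.constant_of_mapsTo (T := {w : ℂ | w ^ n = 1}) hfin.isDiscrete hc
        (fun z hz => hq z hz) (x := z) (y := 1) hz one_ne_zero
      rw [← this, div_mul_cancel₀ _ hz]

theorem rootMap_rootMap_pow {n : ℕ} (hn : n ≠ 0) {a b : ℂ} (hab : ‖a‖ ^ 2 - ‖b‖ ^ 2 = 1)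
    (z : ℂ) : rootMap n (starRingEnd ℂ a) (-b) (rootMap n a b z) ^ n = z ^ n := by
  have h1 : ‖b‖ < ‖a‖ := lt_of_pow_lt_pow_left₀ 2 (norm_nonneg _) (by linarith)
  have h2 : ‖-b‖ < ‖starRingEnd ℂ a‖ := by simpa using h1
  have h3 : starRingEnd ℂ a * a - b * starRingEnd ℂ b = 1 := by
    rw [mul_comm, Complex.mul_conj', Complex.mul_conj']
    exact_mod_cast hab
  rw [rootMap_pow hn h2, ← map_pow, rootMap_pow hn h1]
  simp only [map_add, map_mul, map_pow, Complex.conj_conj]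
  linear_combination (z ^ n) * h3

theorem exists_homeomorph_pow {n : ℕ} (hn : n ≠ 0) {a b : ℂ} (hab : ‖a‖ ^ 2 - ‖b‖ ^ 2 = 1) :
    ∃ ψ : ℂ ≃ₜ ℂ, ψ 0 = 0 ∧ ∀ z, ψ z ^ n = a * z ^ n + b * starRingEnd ℂ z ^ n := by
  have h1 : ‖b‖ < ‖a‖ := lt_of_pow_lt_pow_left₀ 2 (norm_nonneg _) (by linarith)
  have h2 : ‖-b‖ < ‖starRingEnd ℂ a‖ := by simpa using h1
  have hab' : ‖starRingEnd ℂ a‖ ^ 2 - ‖-b‖ ^ 2 = 1 := by simpa using hab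
  set F := rootMap n a b with hF
  set K := rootMap n (starRingEnd ℂ a) (-b) with hK
  have cF : Continuous F := continuous_rootMap h1
  have cK : Continuous K := continuous_rootMap h2
  obtain ⟨ζ, hζ, hKF⟩ := eq_mul_of_pow_eq hn (cK.comp cF) (rootMap_rootMap_pow hn hab)
  obtain ⟨ξ, hξ, hFK⟩ := eq_mul_of_pow_eq hn (cF.comp cK) fun z => by
    simpa using rootMap_rootMap_pow hn hab' z
  have hinj : Function.Injective F := fun x y hxy => by
    have := (hKF x).symm.trans ((congrArg K hxy).trans (hKF y))
    exact mul_left_cancel₀ hζ this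
  have hright : ∀ z, F (K (ξ⁻¹ * z)) = z := fun z => by
    have := hFK (ξ⁻¹ * z)
    rw [mul_inv_cancel_left₀ hξ] at this
    exact this
  exact ⟨{ toFun := F
           invFun := fun z => K (ξ⁻¹ * z)
           left_inv := fun z => hinj (hright (F z))
           right_inv := hright
           continuous_toFun := cF
           continuous_invFun := cK.comp (continuous_const.mul continuous_id) },
    rootMap_zero n a b, fun z => rootMap_pow hn h1 z⟩

theorem exists_homeomorph_toPlane_pow (A : SL2R) {n : ℕ} (hn : n ≠ 0) :
    ∃ ψ : ℂ ≃ₜ ℂ, ψ 0 = 0 ∧ ∀ z, toPlane A (z ^ n) = ψ z ^ n := by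
  have hdet := A.2
  rw [Matrix.det_fin_two] at hdet
  let a : ℂ := ⟨(A.1 0 0 + A.1 1 1) / 2, (A.1 1 0 - A.1 0 1) / 2⟩
  let b : ℂ := ⟨(A.1 0 0 - A.1 1 1) / 2, (A.1 1 0 + A.1 0 1) / 2⟩
  have hab : ‖a‖ ^ 2 - ‖b‖ ^ 2 = 1 := by
    rw [Complex.sq_norm, Complex.sq_norm, Complex.normSq_mk, Complex.normSq_mk]
    linear_combination hdet
  obtain ⟨ψ, h0, hψ⟩ := exists_homeomorph_pow hn hab
  refine ⟨ψ, h0, fun z => ?_⟩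
  rw [hψ, ← map_pow]
  generalize z ^ n = w
  apply Complex.ext <;> simp [toPlane, a, b] <;> ring

end SL2R

/-! ### Translation surfaces -/

/-- A translation structure on a topological surface `X`, that is, a complex structure together
with a holomorphic `1`-form `α` that does not vanish on any open set, recorded through its local
coordinates: near `p`, `coord p` is the function `q ↦ ∫_p^q α` (only the germ of `coord p` at `p`
is meaningful). At a zero of `α` of order `k` the coordinate is the `(k + 1)`-st power of a local
homeomorphism to the plane; at the other points (`k = 0`) it is a local homeomorphism. The change
of coordinates between nearby points is a translation. -/
structure TranslationStructure (X : Type*) [TopologicalSpace X] where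
  /-- the local coordinate `q ↦ ∫_p^q α` -/
  coord : X → X → ℂ
  coord_sub : ∀ p, ∀ᶠ q in 𝓝 p, ∀ᶠ r in 𝓝 q, coord q r = coord p r - coord p q
  local_form : ∀ p, ∃ (k : ℕ) (e : OpenPartialHomeomorph X ℂ), p ∈ e.source ∧ e p = 0 ∧
    ∀ q ∈ e.source, coord p q = e q ^ (k + 1)

namespace TranslationStructure

variable {X Y Z : Type*} [TopologicalSpace X] [TopologicalSpace Y] [TopologicalSpace Z]

/-- Two translation surfaces are translation equivalent if there is a homeomorphism between them
that is a translation in the local coordinates. -/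
def TranslationEquivalent (T : TranslationStructure X) (T' : TranslationStructure Y) : Prop :=
  ∃ φ : X ≃ₜ Y, ∀ p, ∀ᶠ q in 𝓝 p, T'.coord (φ p) (φ q) = T.coord p q

theorem TranslationEquivalent.refl (T : TranslationStructure X) : TranslationEquivalent T T :=
  ⟨Homeomorph.refl X, fun _ => Eventually.of_forall fun _ => rfl⟩

theorem TranslationEquivalent.symm {T : TranslationStructure X} {T' : TranslationStructure Y}
    (h : TranslationEquivalent T T') : TranslationEquivalent T' T := by
  obtain ⟨φ, hφ⟩ := h
  refine ⟨φ.symm, fun p => ?_⟩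
  filter_upwards [φ.symm.continuous.continuousAt.eventually (hφ (φ.symm p))] with q hq
  simpa using hq.symm

theorem TranslationEquivalent.trans {T : TranslationStructure X} {T' : TranslationStructure Y}
    {T'' : TranslationStructure Z} (h : TranslationEquivalent T T')
    (h' : TranslationEquivalent T' T'') : TranslationEquivalent T T'' := by
  obtain ⟨φ, hφ⟩ := h
  obtain ⟨ψ, hψ⟩ := h'
  refine ⟨φ.trans ψ, fun p => ?_⟩
  filter_upwards [hφ p, φ.continuous.continuousAt.eventually (hψ (φ p))] with q h1 h2
  exact h2.trans h1

/-- `A • T` is obtained by postcomposing the local coordinates with the matrix `A`. -/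
instance : SMul SL2R (TranslationStructure X) where
  smul A T :=
    { coord := fun p q => A.toPlane (T.coord p q)
      coord_sub := fun p => (T.coord_sub p).mono fun q hq => hq.mono fun r hr => by
        rw [hr, SL2R.toPlane_sub]
      local_form := fun p => by
        obtain ⟨k, e, hp, h0, he⟩ := T.local_form p
        obtain ⟨ψ, hψ0, hψ⟩ := SL2R.exists_homeomorph_toPlane_pow A k.succ_ne_zero
        refine ⟨k, e.trans ψ.toOpenPartialHomeomorph, by simpa using hp, by simp [h0, hψ0],
          fun q hq => ?_⟩
        rw [he q (by simpa using hq), hψ]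
        simp }

theorem smul_coord (A : SL2R) (T : TranslationStructure X) (p q : X) :
    (A • T).coord p q = A.toPlane (T.coord p q) := rfl

theorem TranslationEquivalent.smul {T : TranslationStructure X} {T' : TranslationStructure Y}
    (h : TranslationEquivalent T T') (A : SL2R) : TranslationEquivalent (A • T) (A • T') := by
  obtain ⟨φ, hφ⟩ := h
  refine ⟨φ, fun p => (hφ p).mono fun q hq => ?_⟩
  rw [smul_coord, smul_coord, hq]

theorem one_smul_equiv (T : TranslationStructure X) :
    TranslationEquivalent ((1 : SL2R) • T) T :=
  ⟨Homeomorph.refl X, fun _ => Eventually.of_forall fun _ => (SL2R.toPlane_one _).symm⟩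

theorem mul_smul_equiv (A B : SL2R) (T : TranslationStructure X) :
    TranslationEquivalent ((A * B) • T) (A • (B • T)) :=
  ⟨Homeomorph.refl X, fun _ => Eventually.of_forall fun _ => (SL2R.toPlane_mul A B _).symm⟩

/-- The Veech group: all `A` such that `A • T` is translation equivalent to `T`. -/
def veechGroup (T : TranslationStructure X) : Subgroup SL2R where
  carrier := {A | TranslationEquivalent (A • T) T}
  one_mem' := one_smul_equiv T
  mul_mem' {A B} hA hB := (mul_smul_equiv A B T).trans ((hB.smul A).trans hA)
  inv_mem' {A} hA := by
    have h := (mul_smul_equiv A⁻¹ A T).symm.trans (by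
      rw [inv_mul_cancel]; exact one_smul_equiv T)
    exact (hA.symm.smul A⁻¹).trans h

/-- The trajectory `g^t T`, `t ≥ 0`, is non-divergent: there are times `t_n → +∞` for which
`g^{t_n} T` converges in the space `SL(2, ℝ) / V(T)` of translation surfaces `A • T` up to
translation equivalence. -/
def NonDivergent (T : TranslationStructure X) : Prop :=
  ∃ (t : ℕ → ℝ) (y : SL2R ⧸ T.veechGroup), Tendsto t atTop atTop ∧
    Tendsto (fun n => (QuotientGroup.mk (SL2R.teich (t n)) : SL2R ⧸ T.veechGroup)) atTop (𝓝 y)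

/-- A chart to the plane that differs locally from the local coordinates by translations. -/
def IsFlatChart (T : TranslationStructure X) (e : OpenPartialHomeomorph X ℂ) : Prop :=
  ∀ p ∈ e.source, ∀ᶠ q in 𝓝 p, e q - e p = T.coord p q

/-- The zeros of the `1`-form. -/
def singularSet (T : TranslationStructure X) : Set X :=
  {p | ¬ ∃ e : OpenPartialHomeomorph X ℂ, T.IsFlatChart e ∧ p ∈ e.source}

/-- `μ` is the area measure of the flat metric: the Borel measure that is Lebesgue measure in the
flat charts, and for which the zeros of the `1`-form are negligible. -/
def IsAreaMeasure (T : TranslationStructure X) (μ : @Measure X (borel X)) : Prop :=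
  (∀ e : OpenPartialHomeomorph X ℂ, T.IsFlatChart e →
    ∀ B : Set X, B ⊆ e.source → MeasurableSet[borel X] B → μ B = volume (e '' B)) ∧
  μ T.singularSet = 0

/-- The translation surface has finite area. -/
def FiniteArea (T : TranslationStructure X) : Prop :=
  ∃ μ : @Measure X (borel X), T.IsAreaMeasure μ ∧ μ univ < ⊤

/-- The translation structure lifted along a local homeomorphism. -/
def pullback (T : TranslationStructure X) (π : Y → X) (hπ : IsLocalHomeomorph π) :
    TranslationStructure Y where
  coord p q := T.coord (π p) (π q)
  coord_sub p := (hπ.continuous.continuousAt.eventually (T.coord_sub (π p))).mono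
    fun _ hq => hπ.continuous.continuousAt.eventually hq
  local_form p := by
    obtain ⟨k, e, hp, h0, he⟩ := T.local_form (π p)
    obtain ⟨f, hf, rfl⟩ := hπ p
    exact ⟨k, f.trans e, by simp [hf, hp], by simpa using h0, fun q hq => by
      simpa using he (f q) (by simpa using (And.right (by simpa using hq)))⟩

/-- Every point has arbitrarily small path-connected open neighbourhoods in which all paths with
the same end points are homotopic. -/
theorem exists_good_nhds (T : TranslationStructure X) {x : X} {V : Set X} (hV : IsOpen V)
    (hx : x ∈ V) : ∃ W : Set X, IsOpen W ∧ x ∈ W ∧ W ⊆ V ∧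
      (∀ a ∈ W, ∀ b ∈ W, ∃ p : Path a b, ∀ t, p t ∈ W) ∧
      ∀ (a b : X) (p q : Path a b), (∀ t, p t ∈ W) → (∀ t, q t ∈ W) → p.Homotopic q := by
  obtain ⟨k, e, hxe, h0, -⟩ := T.local_form x
  have hO : IsOpen (e.target ∩ e.symm ⁻¹' V) := e.isOpen_inter_preimage_symm hV
  have hxO : e x ∈ e.target ∩ e.symm ⁻¹' V := ⟨e.map_source hxe, by simpa [e.left_inv hxe]⟩
  obtain ⟨r, hr, hball⟩ := Metric.isOpen_iff.1 hO _ hxO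
  set B := Metric.ball (e x) r with hB
  have hBt : B ⊆ e.target := fun z hz => (hball hz).1
  have : ContractibleSpace B := Metric.contractibleSpace_ball hr
  have hcont : Continuous fun z : B => e.symm z.1 :=
    e.continuousOn_symm.comp_continuous continuous_subtype_val fun z => hBt z.2
  have hlift : ∀ {a b : X} (p : Path a b) (hp : ∀ t, p t ∈ e.source ∩ e ⁻¹' B),
      Continuous fun t => (⟨e (p t), (hp t).2⟩ : B) :=
    fun p hp => Continuous.subtype_mk
      (e.continuousOn.comp_continuous p.continuous fun t => (hp t).1) _
  refine ⟨e.source ∩ e ⁻¹' B, e.isOpen_inter_preimage Metric.isOpen_ball,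
    ⟨hxe, Metric.mem_ball_self hr⟩, ?_, ?_, ?_⟩
  · rintro y ⟨hy, hyB⟩
    simpa [e.left_inv hy] using (hball hyB).2
  · rintro a ⟨ha, haB⟩ b ⟨hb, hbB⟩
    let p := PathConnectedSpace.somePath (⟨e a, haB⟩ : B) ⟨e b, hbB⟩
    refine ⟨(p.map hcont).cast (e.left_inv ha).symm (e.left_inv hb).symm, fun t => ?_⟩
    have : e.symm (p t).1 ∈ e.source ∩ e ⁻¹' B :=
      ⟨e.map_target (hBt (p t).2), by
        simp only [mem_preimage, e.right_inv (hBt (p t).2)]; exact (p t).2⟩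
    simpa using this
  · intro a b p q hp hq
    have ha : a ∈ e.source ∩ e ⁻¹' B := by simpa using hp 0
    have hb : b ∈ e.source ∩ e ⁻¹' B := by simpa using hp 1
    let p' : Path (⟨e a, ha.2⟩ : B) ⟨e b, hb.2⟩ :=
      { toFun := fun t => ⟨e (p t), (hp t).2⟩
        continuous_toFun := hlift p hp
        source' := by simp
        target' := by simp }
    let q' : Path (⟨e a, ha.2⟩ : B) ⟨e b, hb.2⟩ :=
      { toFun := fun t => ⟨e (q t), (hq t).2⟩
        continuous_toFun := hlift q hq
        source' := by simp
        target' := by simp }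
    have h1 := ((SimplyConnectedSpace.paths_homotopic p' q').map ⟨_, hcont⟩).pathCast
      (e.left_inv ha.1).symm (e.left_inv hb.1).symm
    have hp' : (p'.map hcont).cast (e.left_inv ha.1).symm (e.left_inv hb.1).symm = p := by
      ext t; simp [p', e.left_inv (hp t).1]
    have hq' : (q'.map hcont).cast (e.left_inv ha.1).symm (e.left_inv hb.1).symm = q := by
      ext t; simp [q', e.left_inv (hq t).1]
    rw [← hp', ← hq']
    exact h1

end TranslationStructure

/-- A connected surface has infinite topological type if its fundamental group is not finitely
generated. -/
def InfiniteTopologicalType (S : Type*) [TopologicalSpace S] : Prop :=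
  ∀ s : S, ¬ Group.FG (FundamentalGroup S s)

/-! ### Covers with prescribed monodromy -/

section Covers

variable {S : Type*} [TopologicalSpace S] [PathConnectedSpace S] {s₀ : S} {d : ℕ}
  {G : Subgroup (Equiv.Perm (Fin d))}

/-- A chosen homotopy class of paths from the base point `s₀` to `x`, normalized so that the class
chosen for `x = s₀` is the class of the constant path. -/
def basePath (s₀ x : S) : Path.Homotopic.Quotient s₀ x :=
  (Path.Homotopic.Quotient.mk (PathConnectedSpace.somePath s₀ s₀)).symm.trans
    (Path.Homotopic.Quotient.mk (PathConnectedSpace.somePath s₀ x))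

/-- The permutation of the sheets obtained by following a path `δ` from `x` to `y`: close `δ` up
to a loop at `s₀` by means of the chosen paths, and apply the monodromy representation `h`. Recall
that in Mathlib's fundamental group `γ * γ'` is the class of `γ'` followed by `γ`, so that it acts
from the left on the fibre of a covering. -/
def sheetPerm (h : FundamentalGroup S s₀ →* G) {x y : S} (δ : Path.Homotopic.Quotient x y) :
    Equiv.Perm (Fin d) :=
  (h (FundamentalGroup.fromPath (((basePath s₀ x).trans δ).trans (basePath s₀ y).symm)) :
    Equiv.Perm (Fin d))

theorem sheetPerm_refl (h : FundamentalGroup S s₀ →* G) (x : S) :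
    sheetPerm h (Path.Homotopic.Quotient.refl x) = 1 := by
  have : FundamentalGroup.fromPath (((basePath s₀ x).trans (.refl x)).trans (basePath s₀ x).symm)
      = 1 := by
    simp only [Path.Homotopic.Quotient.trans_refl, Path.Homotopic.Quotient.trans_symm]
    rfl
  rw [sheetPerm, this, map_one]; rfl

theorem sheetPerm_trans (h : FundamentalGroup S s₀ →* G) {x y z : S}
    (δ : Path.Homotopic.Quotient x y) (δ' : Path.Homotopic.Quotient y z) :
    sheetPerm h (δ.trans δ') = sheetPerm h δ' * sheetPerm h δ := by
  have : FundamentalGroup.fromPath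
        (((basePath s₀ x).trans (δ.trans δ')).trans (basePath s₀ z).symm) =
      FundamentalGroup.fromPath (((basePath s₀ y).trans δ').trans (basePath s₀ z).symm) *
        FundamentalGroup.fromPath (((basePath s₀ x).trans δ).trans (basePath s₀ y).symm) := by
    change ((basePath s₀ x).trans (δ.trans δ')).trans (basePath s₀ z).symm =
      (((basePath s₀ x).trans δ).trans (basePath s₀ y).symm).trans
        (((basePath s₀ y).trans δ').trans (basePath s₀ z).symm)
    simp only [Path.Homotopic.Quotient.trans_assoc]
    rw [← Path.Homotopic.Quotient.trans_assoc (basePath s₀ y).symm,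
      Path.Homotopic.Quotient.symm_trans, Path.Homotopic.Quotient.refl_trans]
  rw [sheetPerm, this, map_mul]; rfl

/-- The monodromy at the base point is the given representation. -/
theorem sheetPerm_loop (h : FundamentalGroup S s₀ →* G) (γ : FundamentalGroup S s₀) :
    sheetPerm h (FundamentalGroup.toPath γ) = h γ := by
  have : basePath s₀ s₀ = .refl s₀ := by simp [basePath]
  have h2 : ((Path.Homotopic.Quotient.refl s₀).trans (FundamentalGroup.toPath γ)).trans
      (Path.Homotopic.Quotient.refl s₀).symm = FundamentalGroup.toPath γ := by
    have : (Path.Homotopic.Quotient.refl s₀).symm = .refl s₀ := by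
      rw [← Path.Homotopic.Quotient.mk_refl, ← Path.Homotopic.Quotient.mk_symm, Path.refl_symm]
    rw [this, Path.Homotopic.Quotient.trans_refl, Path.Homotopic.Quotient.refl_trans]
  rw [sheetPerm, this, h2]

/-- The `d`-fold cover of `S` determined by the monodromy representation `h`. Its fibre over every
point is `{1, …, d}`. -/
@[ext]
structure CoverSpace (h : FundamentalGroup S s₀ →* G) where
  /-- the point of `S` below -/
  pt : S
  /-- the sheet -/
  sheet : Fin d

/-- The topology of the cover: a set is open if with each of its points it contains all points
reached by lifting the paths in some neighbourhood in `S`. -/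
instance (h : FundamentalGroup S s₀ →* G) : TopologicalSpace (CoverSpace h) where
  IsOpen U := ∀ z ∈ U, ∃ V : Set S, IsOpen V ∧ z.pt ∈ V ∧
    ∀ (y : S) (δ : Path z.pt y), (∀ t, δ t ∈ V) →
      (⟨y, sheetPerm h (Path.Homotopic.Quotient.mk δ) z.sheet⟩ : CoverSpace h) ∈ U
  isOpen_univ _ _ := ⟨univ, isOpen_univ, mem_univ _, fun _ _ _ => mem_univ _⟩
  isOpen_inter U U' hU hU' z hz := by
    obtain ⟨V, hV, hzV, h1⟩ := hU z hz.1
    obtain ⟨V', hV', hzV', h2⟩ := hU' z hz.2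
    exact ⟨V ∩ V', hV.inter hV', ⟨hzV, hzV'⟩, fun y δ hδ =>
      ⟨h1 y δ fun t => (hδ t).1, h2 y δ fun t => (hδ t).2⟩⟩
  isOpen_sUnion 𝒰 h𝒰 z := by
    rintro ⟨U, hU, hz⟩
    obtain ⟨V, hV, hzV, h1⟩ := h𝒰 U hU z hz
    exact ⟨V, hV, hzV, fun y δ hδ => ⟨U, hU, h1 y δ hδ⟩⟩

theorem CoverSpace.isOpen_iff {h : FundamentalGroup S s₀ →* G} {U : Set (CoverSpace h)} :
    IsOpen U ↔ ∀ z ∈ U, ∃ V : Set S, IsOpen V ∧ z.pt ∈ V ∧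
      ∀ (y : S) (δ : Path z.pt y), (∀ t, δ t ∈ V) →
        (⟨y, sheetPerm h (Path.Homotopic.Quotient.mk δ) z.sheet⟩ : CoverSpace h) ∈ U :=
  Iff.rfl

theorem CoverSpace.continuous_pt (h : FundamentalGroup S s₀ →* G) :
    Continuous (CoverSpace.pt : CoverSpace h → S) :=
  ⟨fun V hV z hz => ⟨V, hV, hz, fun y δ hδ => by
    have := hδ 1
    rwa [δ.target] at this⟩⟩

theorem CoverSpace.isOpenMap_pt (T : TranslationStructure S) (h : FundamentalGroup S s₀ →* G) :
    IsOpenMap (CoverSpace.pt : CoverSpace h → S) := by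
  intro U hU
  rw [isOpen_iff_forall_mem_open]
  rintro _ ⟨z, hz, rfl⟩
  obtain ⟨V, hV, hzV, h1⟩ := CoverSpace.isOpen_iff.1 hU z hz
  obtain ⟨W, hW, hzW, hWV, hconn, -⟩ := T.exists_good_nhds hV hzV
  refine ⟨W, fun y hy => ?_, hW, hzW⟩
  obtain ⟨p, hp⟩ := hconn _ hzW _ hy
  exact ⟨_, h1 y p fun t => hWV (hp t), rfl⟩

/-- The projection of the cover is a local homeomorphism. -/
theorem CoverSpace.isLocalHomeomorph_pt (T : TranslationStructure S)
    (h : FundamentalGroup S s₀ →* G) :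
    IsLocalHomeomorph (CoverSpace.pt : CoverSpace h → S) := by
  rw [isLocalHomeomorph_iff_isOpenEmbedding_restrict]
  intro z
  obtain ⟨W, hW, hzW, -, hconn, hhom⟩ := T.exists_good_nhds isOpen_univ (mem_univ z.pt)
  let U : Set (CoverSpace h) := {w | ∃ δ : Path z.pt w.pt, (∀ t, δ t ∈ W) ∧
    w.sheet = sheetPerm h (Path.Homotopic.Quotient.mk δ) z.sheet}
  have hU : IsOpen U := by
    rw [CoverSpace.isOpen_iff]
    rintro w ⟨δ, hδ, hw⟩
    refine ⟨W, hW, by simpa using hδ 1, fun y δ' hδ' => ⟨δ.trans δ', fun t => ?_, ?_⟩⟩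
    · rw [Path.trans_apply]
      split_ifs
      · exact hδ _
      · exact hδ' _
    · simp only [Path.Homotopic.Quotient.mk_trans, sheetPerm_trans, hw]
      rfl
  have hzU : z ∈ U := ⟨Path.refl _, fun t => by simpa using hzW, by
    rw [Path.Homotopic.Quotient.mk_refl, sheetPerm_refl]; rfl⟩
  refine ⟨U, hU.mem_nhds hzU, .of_continuous_injective_isOpenMap
    ((CoverSpace.continuous_pt h).comp continuous_subtype_val) ?_
    ((CoverSpace.isOpenMap_pt T h).domRestrict hU)⟩
  rintro ⟨⟨x, i⟩, δ, hδ, hi⟩ ⟨⟨y, j⟩, δ', hδ', hj⟩ hxy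
  simp only [domRestrict_apply] at hxy
  subst hxy
  have : Path.Homotopic.Quotient.mk δ = Path.Homotopic.Quotient.mk δ' :=
    Path.Homotopic.Quotient.eq.2 (hhom _ _ δ δ' hδ hδ')
  simp only at hi hj
  exact Subtype.ext (CoverSpace.ext rfl (by
    change i = j
    rw [hi, hj, this]))

/-- The cover with monodromy `h`, with the lifted translation structure. -/
def TranslationStructure.cover (T : TranslationStructure S) (h : FundamentalGroup S s₀ →* G) :
    TranslationStructure (CoverSpace h) :=
  T.pullback CoverSpace.pt (CoverSpace.isLocalHomeomorph_pt T h)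

end Covers

/-! ### Spaces of homomorphisms and the product measure -/

section ProductMeasure

variable {Γ G : Type*} [Group Γ] [Group G]

/-- The topology of pointwise convergence on `Hom(Γ, G)`, with `G` discrete. -/
instance homTopology : TopologicalSpace (Γ →* G) :=
  TopologicalSpace.induced (fun h γ => h γ) (@Pi.topologicalSpace Γ (fun _ => G) fun _ => ⊥)

instance homMeasurableSpace : MeasurableSpace (Γ →* G) := borel (Γ →* G)

instance : BorelSpace (Γ →* G) := ⟨rfl⟩

/-- The uniform probability measure on the finite group `G`. -/
def uniformMeasure (G : Type*) [Group G] : @Measure G ⊤ :=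
  @ProbabilityTheory.uniformOn G ⊤ univ

/-- The product measure on `Hom(Γ, G)`: the images of the elements of a free basis of `Γ` are
chosen independently and uniformly in `G`. -/
def productMeasure {ι : Type*} (b : FreeGroupBasis ι Γ) (G : Type*) [Group G] :
    Measure (Γ →* G) :=
  letI : MeasurableSpace G := ⊤
  Measure.map (fun σ : ι → G => b.lift σ) (Measure.infinitePi fun _ : ι => uniformMeasure G)

theorem measurable_lift {ι : Type*} [Countable ι] (b : FreeGroupBasis ι Γ) [Finite G] :
    letI : MeasurableSpace G := ⊤
    Measurable (fun σ : ι → G => b.lift σ) := by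
  let _ : MeasurableSpace G := ⊤
  let _ : TopologicalSpace G := ⊥
  have : DiscreteTopology G := ⟨rfl⟩
  have : BorelSpace G := ⟨by rw [borel_eq_top_of_discrete]⟩
  have : Countable G := Finite.to_countable
  have hc : Continuous fun σ : ι → G => b.lift σ := by
    refine continuous_induced_rng.2 (continuous_pi fun γ => ?_)
    change Continuous fun σ : ι → G => FreeGroup.lift σ (b.repr γ)
    induction b.repr γ using FreeGroup.induction_on with
    | C1 => simpa using continuous_const
    | of i => simpa using continuous_apply i
    | inv_of i _ =>
      simp only [map_inv, FreeGroup.lift_apply_of]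
      exact (continuous_of_discreteTopology (f := fun g : G => g⁻¹)).comp (continuous_apply i)
    | mul x y hx hy =>
      simp only [map_mul]
      exact (continuous_of_discreteTopology (f := fun g : G × G => g.1 * g.2)).comp
        (hx.prodMk hy)
  exact hc.measurable

theorem isProbabilityMeasure_uniformMeasure [Finite G] :
    @IsProbabilityMeasure G ⊤ (uniformMeasure G) := by
  let _ : MeasurableSpace G := ⊤
  exact ProbabilityTheory.isProbabilityMeasure_uniformOn finite_univ univ_nonempty

instance {ι : Type*} [Countable ι] (b : FreeGroupBasis ι Γ) [Finite G] :
    IsProbabilityMeasure (productMeasure b G) := by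
  let _ : MeasurableSpace G := ⊤
  have := isProbabilityMeasure_uniformMeasure (G := G)
  exact Measure.isProbabilityMeasure_map (measurable_lift b).aemeasurable

/-- The cylinder set prescribing the images of the members of a finite set `s` of generators has
measure `1 / |G| ^ |s|`. -/
theorem productMeasure_cylinder {ι : Type*} [Countable ι] (b : FreeGroupBasis ι Γ) [Finite G]
    (s : Finset ι) (σ : ι → G) :
    productMeasure b G {h | ∀ i ∈ s, h (b i) = σ i} = ((Nat.card G : ENNReal)⁻¹) ^ s.card := by
  let _ : MeasurableSpace G := ⊤
  have := isProbabilityMeasure_uniformMeasure (G := G)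
  have hm : MeasurableSet {h : Γ →* G | ∀ i ∈ s, h (b i) = σ i} := by
    let _ : TopologicalSpace G := ⊥
    have : DiscreteTopology G := ⟨rfl⟩
    have h1 : ∀ γ : Γ, Continuous fun h : Γ →* G => h γ := fun γ =>
      (continuous_apply γ).comp continuous_induced_dom
    have : {h : Γ →* G | ∀ i ∈ s, h (b i) = σ i} = ⋂ i ∈ s, (fun h => h (b i)) ⁻¹' {σ i} := by
      ext; simp
    rw [this]
    exact Finset.measurableSet_biInter s fun i _ =>
      ((isOpen_discrete _).preimage (h1 (b i))).measurableSet
  rw [productMeasure, Measure.map_apply (measurable_lift b) hm]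
  have h2 : (fun σ : ι → G => b.lift σ) ⁻¹' {h | ∀ i ∈ s, h (b i) = σ i} =
      Set.pi s fun i => {σ i} := by
    ext τ; simp [Set.mem_pi]
  have h3 : ∀ g : G, uniformMeasure G {g} = (Nat.card G : ENNReal)⁻¹ := fun g => by
    have := Fintype.ofFinite G
    rw [uniformMeasure, ProbabilityTheory.uniformOn_univ, Measure.count_singleton,
      Nat.card_eq_fintype_card, one_div]
  rw [h2, Measure.infinitePi_pi _ (fun i _ => MeasurableSpace.measurableSet_top)]
  simp [h3]

end ProductMeasure

/-! ### The space of covers up to translation equivalence, and their deformations -/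

namespace TranslationStructure

variable {S : Type*} [TopologicalSpace S] [PathConnectedSpace S] (T : TranslationStructure S)
  (s₀ : S) {d : ℕ} (G : Subgroup (Equiv.Perm (Fin d)))

/-- Two monodromy representations are identified if their covers are translation equivalent. (In
particular representations conjugate in the symmetric group are identified, because their covers
are isomorphic.) -/
def coverSetoid : Setoid (FundamentalGroup S s₀ →* G) where
  r h h' := TranslationEquivalent (T.cover h) (T.cover h')
  iseqv := ⟨fun _ => .refl _, fun h => h.symm, fun h h' => h.trans h'⟩

/-- `Cov_G`: the covers with monodromy in `G`, up to translation equivalence. It has the quotient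
topology. -/
def Cov : Type _ := Quotient (T.coverSetoid s₀ G)

/-- The class of the cover with monodromy `h`. -/
def Cov.mk (h : FundamentalGroup S s₀ →* G) : T.Cov s₀ G := Quotient.mk (T.coverSetoid s₀ G) h

instance : TopologicalSpace (T.Cov s₀ G) :=
  inferInstanceAs (TopologicalSpace (Quotient (T.coverSetoid s₀ G)))

/-- Two points `(A, x)`, `(B, y)` with `x, y ∈ Cov_G` are identified if `A x` and `B y` are
translation equivalent. -/
def deformationSetoid : Setoid (SL2R × T.Cov s₀ G) where
  r u v := ∃ h h' : FundamentalGroup S s₀ →* G, Cov.mk T s₀ G h = u.2 ∧ Cov.mk T s₀ G h' = v.2 ∧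
    TranslationEquivalent (u.1 • T.cover h) (v.1 • T.cover h')
  iseqv := by
    refine ⟨fun u => ?_, ?_, ?_⟩
    · obtain ⟨h, hh⟩ := Quotient.exists_rep u.2
      exact ⟨h, h, hh, hh, .refl _⟩
    · rintro u v ⟨h, h', hu, hv, e⟩
      exact ⟨h', h, hv, hu, e.symm⟩
    · rintro u v w ⟨h, h', hu, hv, e⟩ ⟨k, k', hv', hw, e'⟩
      have h2 : TranslationEquivalent (T.cover h') (T.cover k) :=
        Quotient.exact (hv.trans hv'.symm)
      exact ⟨h, k', hu, hw, e.trans ((h2.smul v.1).trans e')⟩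

/-- The space of all surfaces `A x` with `A ∈ SL(2, ℝ)` and `x ∈ Cov_G`, up to translation
equivalence, as a topological quotient of `SL(2, ℝ) × Cov_G`. -/
def DeformedCov : Type _ := Quotient (T.deformationSetoid s₀ G)

instance : TopologicalSpace (T.DeformedCov s₀ G) :=
  inferInstanceAs (TopologicalSpace (Quotient (T.deformationSetoid s₀ G)))

variable {s₀ G}

/-- The surface `A x`. -/
def DeformedCov.mk (A : SL2R) (x : T.Cov s₀ G) : T.DeformedCov s₀ G :=
  Quotient.mk (T.deformationSetoid s₀ G) (A, x)

/-- The point represents a connected surface. -/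
def DeformedCov.IsConnected (y : T.DeformedCov s₀ G) : Prop :=
  ∃ (A : SL2R) (h : FundamentalGroup S s₀ →* G),
    y = DeformedCov.mk T A (Cov.mk T s₀ G h) ∧ ConnectedSpace (CoverSpace h)

/-- The trajectory `g^t x` has a connected accumulation point: there are times `t_n → +∞` for which
`g^{t_n} x` converges to a point that represents a connected surface. -/
def Cov.HasConnectedAccumulationPoint (x : T.Cov s₀ G) : Prop :=
  ∃ (t : ℕ → ℝ) (y : T.DeformedCov s₀ G), Tendsto t atTop atTop ∧
    Tendsto (fun n => DeformedCov.mk T (SL2R.teich (t n)) x) atTop (𝓝 y) ∧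
    DeformedCov.IsConnected T y

variable {ι : Type*} (b : FreeGroupBasis ι (FundamentalGroup S s₀)) (G)

/-- The sets of covers whose preimage in `Hom(π₁(S), G)` is measurable for the completed product
measure. All Borel sets are among them. -/
@[reducible] def covMeasurableSpace : MeasurableSpace (T.Cov s₀ G) :=
  MeasurableSpace.map (Cov.mk T s₀ G)
    (inferInstanceAs (MeasurableSpace
      (NullMeasurableSpace (FundamentalGroup S s₀ →* G) (productMeasure b G))))

theorem borel_le_covMeasurableSpace : borel (T.Cov s₀ G) ≤ T.covMeasurableSpace G b := by
  refine MeasurableSpace.generateFrom_le fun U hU => ?_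
  have hU' : IsOpen U := hU
  have h1 : IsOpen (Cov.mk T s₀ G ⁻¹' U) := hU'.preimage continuous_quot_mk
  exact h1.measurableSet.nullMeasurableSet

/-- The measure `m_G` on `Cov_G`: the image of the (completed) product measure on
`Hom(π₁(S), G)`. -/
def covMeasure : @Measure (T.Cov s₀ G) (T.covMeasurableSpace G b) :=
  @Measure.map (NullMeasurableSpace (FundamentalGroup S s₀ →* G) (productMeasure b G))
    (T.Cov s₀ G) inferInstance (T.covMeasurableSpace G b) (Cov.mk T s₀ G)
    (productMeasure b G).completion

theorem covMeasure_apply {B : Set (T.Cov s₀ G)} (hB : MeasurableSet[T.covMeasurableSpace G b] B) :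
    T.covMeasure G b B = productMeasure b G (Cov.mk T s₀ G ⁻¹' B) :=
  @Measure.map_apply (NullMeasurableSpace (FundamentalGroup S s₀ →* G) (productMeasure b G))
    (T.Cov s₀ G) inferInstance (T.covMeasurableSpace G b) (productMeasure b G).completion
    (Cov.mk T s₀ G) (fun _ h => h) _ hB

theorem isProbabilityMeasure_covMeasure [Countable ι] :
    @IsProbabilityMeasure _ (T.covMeasurableSpace G b) (T.covMeasure G b) := by
  refine @IsProbabilityMeasure.mk _ (T.covMeasurableSpace G b) _ ?_
  rw [covMeasure_apply T G b (@MeasurableSet.univ _ (T.covMeasurableSpace G b)), preimage_univ,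
    measure_univ]

end TranslationStructure

end

/-!
The trajectory recurs because the Veech group `V` of the base acts on its covers. Non-divergence
gives matrices `A n = g^{t n} * v n` with `v n ∈ V` that converge to some `B`. A homeomorphism of
the base realizing `v n` lifts to the covers and changes the monodromy `h` into `h ∘ θ n`, where
`θ n` is an automorphism of the fundamental group (`smul_cover_equivalent`,
`exists_automorphism_of_mem_veechGroup`). Hence `g^{t n}` applied to the cover with monodromy `h` is
`A n` applied to the cover with monodromy `h ∘ θ n`. As `Hom(π₁, G)` is sequentially compact, a
subsequence of the latter converges to `B` applied to the cover with some limit monodromy. The only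
danger is that this limit cover is disconnected.

It is connected as soon as, for infinitely many `n`, the homomorphism `h ∘ θ n` takes all values in
`G` already on a fixed finite set `s` of generators, since this property passes to the limit
(`hasConnectedAccumulationPoint_of_frequently`). For each `n` this fails with probability at most
`|G| (1 - 1 / |G|) ^ |s|`, because the product measure is invariant under automorphisms of the free
group: the values at finitely many members of any free basis are independent and uniform
(`productMeasure_cylinder_of_basis`). The probability that it fails for all large `n` has the same
bound, which tends to `0` as `s` grows; the rank is infinite, so `s` can be arbitrarily large.

The invariance of the measure rests on the fact that members of a free basis that lie in a subgroup
`H` are part of a free basis of `H`, in the form that a homomorphism on `H` can be given arbitrary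
new values at them without loss of other information (`FreeGroupBasis.exists_replace`). For `H`
generated by finitely many members of another basis, `Hom(H, G)` is finite, and all values at those
members are taken by equally many homomorphisms.
-/

/-! ### Homomorphisms on subgroups of a free group -/

section FreeFactor

variable {Γ ι : Type*} [Group Γ]

theorem FreeGroupBasis.closure_range (c : FreeGroupBasis ι Γ) :
    Subgroup.closure (range c) = ⊤ := by
  have h : MonoidHom.range c.repr.symm.toMonoidHom = ⊤ :=
    MonoidHom.range_eq_top.2 c.repr.symm.surjective
  rw [← h, MonoidHom.range_eq_map, ← FreeGroup.closure_range_of, MonoidHom.map_closure,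
    ← range_comp]
  rfl

/-- On a free group there is a function that changes under left multiplication by the basis elements
by prescribed factors: the basis elements act on `Γ × G` by `(g, a) ↦ (c i * g, v i g * a)`. -/
theorem FreeGroupBasis.exists_cocycle {G : Type*} [Group G] (c : FreeGroupBasis ι Γ)
    (v : ι → Γ → G) : ∃ s : Γ → G, s 1 = 1 ∧ ∀ i g, s (c i * g) = v i g * s g := by
  let P : ι → Equiv.Perm (Γ × G) := fun i =>
    { toFun := fun x => (c i * x.1, v i x.1 * x.2)
      invFun := fun x => ((c i)⁻¹ * x.1, (v i ((c i)⁻¹ * x.1))⁻¹ * x.2)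
      left_inv := fun x => by simp
      right_inv := fun x => by simp }
  let ρ : Γ →* Equiv.Perm (Γ × G) := c.lift P
  have hρ : ∀ i x, ρ (c i) x = (c i * x.1, v i x.1 * x.2) := fun i x => by
    simp [ρ, P]
  have h1 : ∀ g x, (ρ g x).1 = g * x.1 := by
    intro g
    have : g ∈ Subgroup.closure (range c) := by rw [c.closure_range]; trivial
    induction this using Subgroup.closure_induction with
    | mem g hg => obtain ⟨i, rfl⟩ := hg; intro x; rw [hρ]
    | one => intro x; simp
    | mul g h _ _ hg hh => intro x; rw [map_mul, Equiv.Perm.mul_apply, hg, hh, mul_assoc]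
    | inv g _ hg =>
      intro x
      have := hg (ρ g⁻¹ x)
      rw [← Equiv.Perm.mul_apply, ← map_mul, mul_inv_cancel, map_one, Equiv.Perm.one_apply] at this
      rw [this, inv_mul_cancel_left]
  refine ⟨fun g => (ρ g (1, 1)).2, by simp, fun i g => ?_⟩
  simp only [map_mul, Equiv.Perm.mul_apply, hρ, h1, mul_one]

theorem FreeGroupBasis.cocycle_unique {G : Type*} [Group G] (c : FreeGroupBasis ι Γ)
    {v : ι → Γ → G} {s s' : Γ → G} (h1 : s 1 = s' 1)
    (hs : ∀ i g, s (c i * g) = v i g * s g) (hs' : ∀ i g, s' (c i * g) = v i g * s' g) :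
    s = s' := by
  have key : ∀ g : Γ, ∀ x, s x = s' x ↔ s (g * x) = s' (g * x) := by
    intro g
    have : g ∈ Subgroup.closure (range c) := by rw [c.closure_range]; trivial
    induction this using Subgroup.closure_induction with
    | mem g hg => obtain ⟨i, rfl⟩ := hg; intro x; rw [hs, hs', mul_right_inj]
    | one => intro x; simp
    | mul g h _ _ hg hh => intro x; rw [hh, hg, mul_assoc]
    | inv g _ hg => intro x; rw [hg (g⁻¹ * x), mul_inv_cancel_left]
  funext g
  simpa using (key g 1).1 h1

/-- A homomorphism on a subgroup extends to an equivariant function on the whole group. -/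
theorem Subgroup.exists_equivariant {G : Type*} [Group G] (H : Subgroup Γ) (h : H →* G) :
    ∃ s : Γ → G, s 1 = 1 ∧ ∀ g (η : H), s (g * η) = s g * h η := by
  classical
  let t : Γ ⧸ H → Γ := fun q => if q = ((1 : Γ) : Γ ⧸ H) then 1 else q.out
  have ht : ∀ q : Γ ⧸ H, (t q : Γ ⧸ H) = q := fun q => by
    by_cases hq : q = ((1 : Γ) : Γ ⧸ H) <;> simp [t, hq]
  have hm : ∀ g : Γ, (t g)⁻¹ * g ∈ H := fun g => QuotientGroup.eq.1 (ht g)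
  refine ⟨fun g => h ⟨_, hm g⟩, ?_, fun g η => ?_⟩
  · have : t ((1 : Γ) : Γ ⧸ H) = 1 := by simp [t]
    rw [← map_one h]
    exact congrArg h (Subtype.ext (by simp [this]))
  · have : ((g * η : Γ) : Γ ⧸ H) = g := QuotientGroup.mk_mul_of_mem _ η.2
    rw [← map_mul]
    exact congrArg h (Subtype.ext (by simp [this, mul_assoc]))

/-- Members `c i`, `i ∈ J`, of a free basis that lie in a subgroup `H` are part of a free basis of
`H`. Hence the values of a homomorphism on `H` at the `c i` can be replaced by arbitrary ones, and
the replacement loses no information besides the old values.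

The equivariant extension `s` of `h` to the whole group satisfies
`s (c i * g) = v i g * s g`, where `v i` is constant on the cosets `g H`; the new homomorphism
comes from changing `v i` on the coset `H` for `i ∈ J`. -/
theorem FreeGroupBasis.exists_replace {G : Type*} [Group G] (c : FreeGroupBasis ι Γ)
    (H : Subgroup Γ) (J : Set ι) (hJ : ∀ i ∈ J, c i ∈ H) (τ : ι → G) :
    ∃ R : (H →* G) → (H →* G), (∀ h i (hi : i ∈ J), R h ⟨c i, hJ i hi⟩ = τ i) ∧
      ∀ h h', (∀ i (hi : i ∈ J), h ⟨c i, hJ i hi⟩ = h' ⟨c i, hJ i hi⟩) → R h = R h' →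
        h = h' := by
  classical
  choose s hs1 hs using fun h : H →* G => H.exists_equivariant h
  have hsH : ∀ h (η : H), s h η = h η := fun h η => by simpa [hs1] using hs h 1 η
  let v : (H →* G) → ι → Γ → G := fun h i g =>
    if i ∈ J ∧ g ∈ H then τ i else s h (c i * g) * (s h g)⁻¹
  have hv : ∀ h i g (η : H), v h i (g * η) = v h i g := fun h i g η => by
    simp only [v, H.mul_mem_cancel_right η.2, ← mul_assoc (c i), hs, mul_inv_rev]
    simp [mul_assoc]
  choose u hu1 hu using fun h => c.exists_cocycle (v h)
  have hmul : ∀ h g (η : H), u h (g * η) = u h g * u h η := fun h g η => by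
    have := c.cocycle_unique (v := v h) (s := fun g => u h (g * η) * (u h η)⁻¹) (s' := u h)
      (by simp [hu1]) (fun i g => by simp only [mul_assoc (c i), hu, hv]; simp only [mul_assoc])
      (hu h)
    rw [← congrFun this g]
    simp
  let R : (H →* G) → (H →* G) := fun h =>
    { toFun := fun η => u h η
      map_one' := hu1 h
      map_mul' := fun η η' => hmul h η η' }
  refine ⟨R, fun h i hi => ?_, fun h h' hc hR => ?_⟩
  · have := hu h i 1
    change u h (c i) = τ i
    simpa [v, hi, H.one_mem, hu1] using this
  · have hRu : ∀ η : H, u h η = u h' η := fun η => DFunLike.congr_fun hR η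
    -- `p` depends only on the coset `g H`, is `1` on `H`, and carries the extension of `h` to that
    -- of `h'`
    let p : Γ → G := fun g => u h' g * (u h g)⁻¹
    have hp : ∀ g (η : H), p (g * η) = p g := fun g η => by
      simp only [p, hmul h, hmul h', hRu]; group
    have hpH : ∀ g ∈ H, p g = 1 := fun g hg => by
      have := hp 1 ⟨g, hg⟩
      simpa [p, hu1] using this
    have key := c.cocycle_unique (v := fun i g => s h' (c i * g) * (s h' g)⁻¹)
      (s := fun g => p g * s h g) (s' := s h') (by simp [hs1, p, hu1]) (fun i g => ?_)
      (fun i g => by simp)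
    · ext η
      have := congrFun key η
      simpa [hpH _ η.2, hsH] using this
    · by_cases hig : i ∈ J ∧ g ∈ H
      · obtain ⟨hi, hg⟩ := hig
        have hcH := hJ i hi
        have h1 := hs h (c i) ⟨g, hg⟩
        have h2 := hs h' (c i) ⟨g, hg⟩
        have h3 := hsH h ⟨g, hg⟩
        have h4 := hsH h' ⟨g, hg⟩
        have h5 := hsH h ⟨c i, hcH⟩
        have h6 := hsH h' ⟨c i, hcH⟩
        simp only at h1 h2 h3 h4 h5 h6
        simp only [hpH _ hg, hpH _ (H.mul_mem hcH hg), h1, h2, h3, h4, h5, h6, hc i hi]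
        group
      · have e1 := hu h i g
        have e2 := hu h' i g
        simp only [v, if_neg hig] at e1 e2
        simp only [p, e1, e2]
        group

end FreeFactor

/-! ### The product measure does not depend on the free basis -/

section Uniform

variable {Γ G ι κ : Type*} [Group Γ] [Group G]

theorem measurableSet_eval_mem (γ : Γ) (B : Set G) : MeasurableSet {h : Γ →* G | h γ ∈ B} := by
  let _ : TopologicalSpace G := ⊥
  have : DiscreteTopology G := ⟨rfl⟩
  have h1 : Continuous fun h : Γ →* G => h γ :=
    (continuous_apply γ).comp continuous_induced_dom
  exact ((isOpen_discrete B).preimage h1).measurableSet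

/-- A finite set of elements of a free group lies in the subgroup generated by finitely many
members of a given free basis. -/
theorem FreeGroupBasis.exists_finset_mem_closure (b : FreeGroupBasis ι Γ) (A : Finset Γ) :
    ∃ I : Finset ι, ∀ a ∈ A, a ∈ Subgroup.closure (b '' (I : Set ι)) := by
  classical
  have h1 : ∀ a : Γ, ∃ I : Finset ι, a ∈ Subgroup.closure (b '' (I : Set ι)) := by
    intro a
    have : a ∈ Subgroup.closure (range b) := by rw [b.closure_range]; trivial
    have mono : ∀ {I J : Finset ι}, I ⊆ J →
        Subgroup.closure (b '' (I : Set ι)) ≤ Subgroup.closure (b '' (J : Set ι)) := fun h =>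
      Subgroup.closure_mono (image_mono (Finset.coe_subset.2 h))
    induction this using Subgroup.closure_induction with
    | mem g hg =>
      obtain ⟨i, rfl⟩ := hg
      exact ⟨{i}, Subgroup.subset_closure (mem_image_of_mem b (by simp))⟩
    | one => exact ⟨∅, one_mem _⟩
    | mul g h _ _ hg hh =>
      obtain ⟨I, hI⟩ := hg
      obtain ⟨J, hJ⟩ := hh
      exact ⟨I ∪ J, mul_mem (mono Finset.subset_union_left hI)
        (mono Finset.subset_union_right hJ)⟩
    | inv g _ hg => exact hg.imp fun I hI => inv_mem hI
  choose I hI using h1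
  refine ⟨A.biUnion I, fun a ha => Subgroup.closure_mono (image_mono ?_) (hI a)⟩
  exact Finset.coe_subset.2 (Finset.subset_biUnion_of_mem I ha)

open scoped Classical in
/-- The values of a random homomorphism at finitely many members of any free basis `c` are
uniformly distributed, although the product measure is defined by another basis `b`.

All these members lie in a free factor `H` generated by finitely many members of `b`; the
restriction of the random homomorphism to `H` is uniformly distributed on the finite set
`Hom(H, G)`, and there all values at the members of `c` in `H` are taken equally often. -/
theorem productMeasure_cylinder_of_basis [Countable ι] [Finite G] (b : FreeGroupBasis ι Γ)
    (c : FreeGroupBasis κ Γ) (s : Finset κ) (σ : κ → G) :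
    productMeasure b G {h | ∀ i ∈ s, h (c i) = σ i} = ((Nat.card G : ENNReal)⁻¹) ^ s.card := by
  have := Fintype.ofFinite G
  set μ := productMeasure b G with hμ
  obtain ⟨I, hI⟩ := b.exists_finset_mem_closure (s.image c)
  set H := Subgroup.closure (b '' (I : Set ι)) with hH
  have hcH : ∀ i ∈ s, c i ∈ H := fun i hi => hI _ (Finset.mem_image_of_mem c hi)
  have hbH : ∀ i ∈ I, b i ∈ H := fun i hi =>
    Subgroup.subset_closure (mem_image_of_mem b (Finset.mem_coe.2 hi))
  have hagree : ∀ {k k' : H →* G}, (∀ i (hi : i ∈ I), k ⟨b i, hbH i hi⟩ = k' ⟨b i, hbH i hi⟩) →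
      k = k' := by
    intro k k' hk
    ext ⟨x, hx⟩
    induction hx using Subgroup.closure_induction with
    | mem g hg => obtain ⟨i, hi, rfl⟩ := hg; exact hk i hi
    | one => rw [show (⟨1, one_mem _⟩ : H) = 1 from rfl, map_one, map_one]
    | mul g g' hg hg' e e' =>
      have : (⟨g * g', mul_mem hg hg'⟩ : H) = ⟨g, hg⟩ * ⟨g', hg'⟩ := rfl
      rw [this, map_mul, map_mul, e, e']
    | inv g hg e =>
      have : (⟨g⁻¹, inv_mem hg⟩ : H) = ⟨g, hg⟩⁻¹ := rfl
      rw [this, map_inv, map_inv, e]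
  have : Finite (H →* G) := Finite.of_injective
    (fun (k : H →* G) (i : I) => k ⟨b i, hbH i i.2⟩) fun k k' h =>
      hagree fun i hi => congrFun h ⟨i, hi⟩
  have := Fintype.ofFinite (H →* G)
  have hres : ∀ k : H →* G, μ {h | h.comp H.subtype = k} = ((Nat.card G : ENNReal)⁻¹) ^ I.card := by
    intro k
    rw [← productMeasure_cylinder b I fun i => if hi : i ∈ I then k ⟨b i, hbH i hi⟩ else 1]
    congr 1
    ext h
    simp only [mem_ofPred_eq]
    constructor
    · rintro rfl i hi
      simp [hi]
    · intro hh
      refine hagree fun i hi => ?_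
      have := hh i hi
      simp only [hi, dif_pos] at this
      simpa using this
  have hmeas : ∀ k : H →* G, MeasurableSet {h : Γ →* G | h.comp H.subtype = k} := by
    intro k
    have : {h : Γ →* G | h.comp H.subtype = k} =
        ⋂ i ∈ I, {h : Γ →* G | h (b i) ∈ {g | ∀ hi : i ∈ I, g = k ⟨b i, hbH i hi⟩}} := by
      ext h
      simp only [mem_ofPred_eq, mem_iInter]
      constructor
      · rintro rfl i hi hi'
        rfl
      · exact fun hh => hagree fun i hi => hh i hi hi
    rw [this]
    exact Finset.measurableSet_biInter _ fun i _ => measurableSet_eval_mem _ _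
  -- the homomorphisms on `H` with prescribed values at the members of `c`
  let F : (s → G) → Finset (H →* G) := fun τ =>
    Finset.univ.filter fun k => ∀ i : s, k ⟨c i, hcH i i.2⟩ = τ i
  have hμF : ∀ τ : s → G, μ {h | ∀ i : s, h (c i) = τ i} =
      (F τ).card * ((Nat.card G : ENNReal)⁻¹) ^ I.card := by
    intro τ
    have : {h : Γ →* G | ∀ i : s, h (c i) = τ i} =
        ⋃ k ∈ F τ, {h : Γ →* G | h.comp H.subtype = k} := by
      ext h
      simp only [mem_ofPred_eq, mem_iUnion, F, Finset.mem_filter, Finset.mem_univ, true_and]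
      constructor
      · exact fun hh => ⟨_, hh, rfl⟩
      · rintro ⟨k, hk, rfl⟩
        exact hk
    rw [this, measure_biUnion_finset (fun k _ k' _ hkk => ?_) fun k _ => hmeas k]
    · simp [hres]
    · exact Set.disjoint_left.2 fun h h1 h2 => hkk (h1.symm.trans h2)
  have hle : ∀ τ τ', (F τ).card ≤ (F τ').card := by
    intro τ τ'
    obtain ⟨R, hR1, hR2⟩ := c.exists_replace H (s : Set κ) (fun i hi => hcH i hi)
      fun i => if hi : i ∈ s then τ' ⟨i, hi⟩ else 1
    refine Finset.card_le_card_of_injOn R (fun k _ => ?_) fun k hk k' hk' hkk => ?_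
    · simp only [F, Finset.coe_filter, Finset.mem_univ, true_and, mem_ofPred_eq]
      intro i
      rw [hR1 k i i.2]
      simp
    · simp only [F, Finset.coe_filter, Finset.mem_univ, true_and, mem_ofPred_eq] at hk hk'
      exact hR2 k k' (fun i hi => (hk ⟨i, hi⟩).trans (hk' ⟨i, hi⟩).symm) hkk
  have hconst : ∀ τ τ' : s → G, μ {h | ∀ i : s, h (c i) = τ i} =
      μ {h | ∀ i : s, h (c i) = τ' i} := fun τ τ' => by
    rw [hμF, hμF, (hle τ τ').antisymm (hle τ' τ)]
  have hmeas' : ∀ τ : s → G, MeasurableSet {h : Γ →* G | ∀ i : s, h (c i) = τ i} := by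
    intro τ
    have : {h : Γ →* G | ∀ i : s, h (c i) = τ i} =
        ⋂ i : s, {h : Γ →* G | h (c i) ∈ ({τ i} : Set G)} := by
      ext h; simp
    rw [this]
    exact MeasurableSet.iInter fun i => measurableSet_eval_mem _ _
  have hsum : ∑ τ : s → G, μ {h | ∀ i : s, h (c i) = τ i} = 1 := by
    rw [← measure_univ (μ := μ), ← measure_biUnion_finset (fun τ _ τ' _ hττ => ?_)
      fun τ _ => hmeas' τ]
    · congr 1
      ext h
      simp only [mem_iUnion, Finset.mem_univ, mem_ofPred_eq, mem_univ, iff_true]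
      exact ⟨fun i => h (c i), trivial, fun i => rfl⟩
    · exact Set.disjoint_left.2 fun h h1 h2 =>
        hττ (funext fun i => (h1 i).symm.trans (h2 i))
  have hset : {h : Γ →* G | ∀ i ∈ s, h (c i) = σ i} = {h | ∀ i : s, h (c i) = σ i} := by
    ext h; simp
  rw [Finset.sum_congr rfl fun τ _ => hconst τ fun i => σ i, Finset.sum_const, Finset.card_univ,
    nsmul_eq_mul, Fintype.card_fun, Fintype.card_coe, mul_comm] at hsum
  rw [hset, ENNReal.eq_inv_of_mul_eq_one_left hsum, Nat.card_eq_fintype_card, Nat.cast_pow,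
    ENNReal.inv_pow]

/-- Random homomorphisms that do not take all values already on a finite set of members of a free
basis are rare if the finite set is large. -/
theorem productMeasure_not_surjOn_le [Countable ι] [Finite G] (b : FreeGroupBasis ι Γ)
    (c : FreeGroupBasis κ Γ) (s : Finset κ) :
    productMeasure b G {h | ¬ ∀ g, ∃ i ∈ s, h (c i) = g} ≤
      Nat.card G * (((Nat.card G - 1 : ℕ) : ENNReal) * (Nat.card G : ENNReal)⁻¹) ^ s.card := by
  classical
  have := Fintype.ofFinite G
  have hsub : {h : Γ →* G | ¬ ∀ g, ∃ i ∈ s, h (c i) = g} ⊆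
      ⋃ g : G, ⋃ τ : s → {x : G // x ≠ g},
        {h | ∀ i ∈ s, h (c i) = if hi : i ∈ s then (τ ⟨i, hi⟩ : G) else 1} := by
    intro h hh
    simp only [mem_ofPred_eq, not_forall, not_exists, not_and] at hh
    obtain ⟨g, hg⟩ := hh
    simp only [mem_iUnion, mem_ofPred_eq]
    exact ⟨g, fun i => ⟨h (c i), hg i i.2⟩, fun i hi => by simp [hi]⟩
  refine (measure_mono hsub).trans ((measure_iUnion_fintype_le _ _).trans ?_)
  refine (Finset.sum_le_sum fun g _ => measure_iUnion_fintype_le _ _).trans ?_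
  simp only [productMeasure_cylinder_of_basis, Finset.sum_const, Finset.card_univ,
    Fintype.card_fun, Fintype.card_coe, nsmul_eq_mul, Fintype.card_subtype_compl,
    Fintype.card_subtype_eq, Nat.card_eq_fintype_card, mul_pow, Nat.cast_pow, le_refl]

/-- Let `c n` be free bases with the same infinite index set. Almost every homomorphism takes, for
infinitely many `n`, all values already on the members of `c n` with indices in a finite set that
does not depend on `n`. -/
theorem ae_exists_frequently_surjOn [Countable ι] [Infinite κ] [Finite G]
    (b : FreeGroupBasis ι Γ) (c : ℕ → FreeGroupBasis κ Γ) :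
    ∀ᵐ h ∂(productMeasure b G), ∃ s : Finset κ, ∃ᶠ n in atTop, ∀ g, ∃ i ∈ s, h (c n i) = g := by
  set μ := productMeasure b G
  let q : ENNReal := ((Nat.card G - 1 : ℕ) : ENNReal) * (Nat.card G : ENNReal)⁻¹
  have hcard : 0 < Nat.card G := Nat.card_pos
  have hq : q < 1 := by
    change _ * _ < _
    rw [← div_eq_mul_inv, ENNReal.div_lt_iff (by simp [hcard.ne']) (by simp), one_mul]
    exact_mod_cast Nat.sub_lt hcard one_pos
  have hlim : Tendsto (fun k : ℕ => (Nat.card G : ENNReal) * q ^ k) atTop (𝓝 0) := by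
    simpa using ENNReal.Tendsto.const_mul (ENNReal.tendsto_pow_atTop_nhds_zero_of_lt_one hq)
      (Or.inr (ENNReal.natCast_ne_top (Nat.card G)))
  rw [ae_iff]
  refine le_antisymm (ge_of_tendsto' hlim fun k => ?_) zero_le
  obtain ⟨s, hs⟩ := Infinite.exists_subset_card_eq κ k
  let B : ℕ → Set (Γ →* G) := fun n => {h | ¬ ∀ g, ∃ i ∈ s, h (c n i) = g}
  have hsub : {h : Γ →* G | ¬ ∃ s : Finset κ, ∃ᶠ n in atTop, ∀ g, ∃ i ∈ s, h (c n i) = g} ⊆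
      ⋃ m, ⋂ n ≥ m, B n := by
    intro h hh
    simp only [mem_ofPred_eq, not_exists, not_frequently] at hh
    obtain ⟨m, hm⟩ := eventually_atTop.1 (hh s)
    simp only [mem_iUnion, mem_iInter]
    exact ⟨m, fun n hn => hm n hn⟩
  have hmono : Monotone fun m => ⋂ n ≥ m, B n := fun m m' hmm =>
    biInter_subset_biInter_left fun n hn => le_trans hmm hn
  refine (measure_mono hsub).trans ?_
  rw [hmono.measure_iUnion]
  refine iSup_le fun m => (measure_mono (biInter_subset_of_mem (le_refl m))).trans ?_
  have := productMeasure_not_surjOn_le (G := G) b (c m) s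
  rwa [hs] at this

end Uniform

/-! ### Maps of spaces and homotopy classes of paths -/

section Paths

theorem Path.Homotopic.Quotient.map_trans {X Y : Type*} [TopologicalSpace X] [TopologicalSpace Y]
    {x y z : X} (δ : Path.Homotopic.Quotient x y) (δ' : Path.Homotopic.Quotient y z) (f : C(X, Y)) :
    (δ.trans δ').map f = (δ.map f).trans (δ'.map f) := by
  induction δ with
  | mk δ =>
    induction δ' with
    | mk δ' =>
      rw [← mk_trans, ← mk_map, ← mk_map, ← mk_map, Path.map_trans, mk_trans]

theorem Path.Homotopic.Quotient.map_symm {X Y : Type*} [TopologicalSpace X] [TopologicalSpace Y]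
    {x y : X} (δ : Path.Homotopic.Quotient x y) (f : C(X, Y)) :
    δ.symm.map f = (δ.map f).symm := by
  induction δ with
  | mk δ => rw [← mk_symm, ← mk_map, ← mk_map, ← Path.map_symm, mk_symm]

theorem Path.Homotopic.Quotient.map_injective_of_comp_eq_id {X Y : Type*} [TopologicalSpace X]
    [TopologicalSpace Y] {f : C(X, Y)} {g : C(Y, X)} (hgf : g.comp f = ContinuousMap.id X)
    {x y : X} : Function.Injective fun δ : Path.Homotopic.Quotient x y => δ.map f := by
  intro δ δ' h
  have h1 : δ.map (g.comp f) = δ'.map (g.comp f) := by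
    rw [map_comp, map_comp]
    exact congrArg (fun ε => ε.map g) h
  rw [hgf] at h1
  induction δ with
  | mk δ =>
    induction δ' with
    | mk δ' => exact h1

theorem Path.Homotopic.Quotient.exists_map_eq {X Y : Type*} [TopologicalSpace X]
    [TopologicalSpace Y] (φ : X ≃ₜ Y) {x y : X} (δ : Path.Homotopic.Quotient (φ x) (φ y)) :
    ∃ δ' : Path.Homotopic.Quotient x y, δ'.map (φ : C(X, Y)) = δ := by
  induction δ with
  | mk δ =>
    refine ⟨mk ((δ.map φ.symm.continuous).cast (φ.symm_apply_apply x).symm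
      (φ.symm_apply_apply y).symm), ?_⟩
    rw [← mk_map]
    congr 1
    ext t
    simp

variable {S : Type*} [TopologicalSpace S] {s₀ : S}

/-- The endomorphism of the fundamental group induced by a map of the space, where the base point is
transported back along a path `β`. -/
noncomputable def FundamentalGroup.mapAlong (φ : C(S, S)) (β : Path.Homotopic.Quotient s₀ (φ s₀)) :
    FundamentalGroup S s₀ →* FundamentalGroup S s₀ :=
  MonoidHom.mk' (fun γ => FundamentalGroup.fromPath
      ((β.trans ((FundamentalGroup.toPath γ).map φ)).trans β.symm)) fun γ γ' => by
    change (β.trans (((FundamentalGroup.toPath γ').trans (FundamentalGroup.toPath γ)).map φ)).trans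
        β.symm =
      ((β.trans ((FundamentalGroup.toPath γ').map φ)).trans β.symm).trans
        ((β.trans ((FundamentalGroup.toPath γ).map φ)).trans β.symm)
    simp only [Path.Homotopic.Quotient.map_trans, Path.Homotopic.Quotient.trans_assoc]
    rw [← Path.Homotopic.Quotient.trans_assoc β.symm,
      Path.Homotopic.Quotient.symm_trans, Path.Homotopic.Quotient.refl_trans]

theorem FundamentalGroup.bijective_mapAlong (φ : S ≃ₜ S)
    (β : Path.Homotopic.Quotient s₀ (φ s₀)) :
    Function.Bijective (FundamentalGroup.mapAlong (φ : C(S, S)) β) := by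
  constructor
  · intro γ γ' h
    have h1 : (β.trans ((FundamentalGroup.toPath γ).map (φ : C(S, S)))).trans β.symm =
      (β.trans ((FundamentalGroup.toPath γ').map (φ : C(S, S)))).trans β.symm := h
    have h2 := congrArg (fun ε => β.symm.trans (ε.trans β)) h1
    simp only [Path.Homotopic.Quotient.trans_assoc] at h2
    simp only [Path.Homotopic.Quotient.symm_trans, Path.Homotopic.Quotient.trans_refl,
      ← Path.Homotopic.Quotient.trans_assoc β.symm, Path.Homotopic.Quotient.refl_trans] at h2
    exact Path.Homotopic.Quotient.map_injective_of_comp_eq_id (g := (φ.symm : C(S, S)))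
      (by ext; simp) h2
  · intro γ
    obtain ⟨δ, hδ⟩ := Path.Homotopic.Quotient.exists_map_eq φ
      (β.symm.trans ((FundamentalGroup.toPath γ).trans β))
    refine ⟨FundamentalGroup.fromPath δ, ?_⟩
    change (β.trans (δ.map (φ : C(S, S)))).trans β.symm = FundamentalGroup.toPath γ
    rw [hδ]
    simp only [← Path.Homotopic.Quotient.trans_assoc, Path.Homotopic.Quotient.trans_symm,
      Path.Homotopic.Quotient.refl_trans]
    rw [Path.Homotopic.Quotient.trans_assoc, Path.Homotopic.Quotient.trans_symm,
      Path.Homotopic.Quotient.trans_refl]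

end Paths

/-! ### Topology of the covers -/

section Covers

variable {S : Type*} [TopologicalSpace S] [PathConnectedSpace S] {s₀ : S} {d : ℕ}
  {G : Subgroup (Equiv.Perm (Fin d))}

/-- Moving along a path in the base lifts to a continuous motion in the cover. -/
theorem CoverSpace.continuous_lift (h : FundamentalGroup S s₀ →* G) {x y : S} (δ : Path x y)
    (i : Fin d) : Continuous fun t : unitInterval =>
      (⟨δ t, sheetPerm h (Path.Homotopic.Quotient.mk (δ.subpath 0 t)) i⟩ : CoverSpace h) := by
  rw [continuous_iff_continuousAt]
  intro t
  rw [ContinuousAt, tendsto_nhds]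
  intro U hU ht
  obtain ⟨V, hV, htV, h1⟩ := CoverSpace.isOpen_iff.1 hU _ ht
  obtain ⟨ε, hε, hball⟩ := Metric.isOpen_iff.1 (hV.preimage δ.continuous) t htV
  filter_upwards [Metric.ball_mem_nhds t hε] with t' ht'
  have hsub : ∀ u, δ.subpath t t' u ∈ V := by
    intro u
    have hu : δ.subpath t t' u ∈ range (δ.subpath t t') := mem_range_self u
    rw [Path.range_subpath] at hu
    obtain ⟨w, hw, hwu⟩ := hu
    rw [← hwu]
    refine hball ?_
    rw [Metric.mem_ball] at ht' ⊢
    refine lt_of_le_of_lt ?_ ht'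
    have hw' : (w : ℝ) ∈ uIcc (t : ℝ) t' := by
      rcases le_total t t' with h | h
      · rw [uIcc_of_le h] at hw
        rw [uIcc_of_le (show (t : ℝ) ≤ t' from h)]; exact hw
      · rw [uIcc_of_ge h] at hw
        rw [uIcc_of_ge (show (t' : ℝ) ≤ t from h)]; exact hw
    rw [Subtype.dist_eq, Subtype.dist_eq, dist_comm _ (t : ℝ), dist_comm _ (t : ℝ)]
    exact Real.dist_left_le_of_mem_uIcc hw'
  have := h1 _ (δ.subpath t t') hsub
  rwa [← Equiv.Perm.mul_apply, ← sheetPerm_trans, ← Path.Homotopic.Quotient.mk_trans,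
    Path.Homotopic.Quotient.eq.2 ⟨Path.Homotopy.subpathTransSubpath δ 0 t t'⟩] at this

/-- The end points of a lifted path are joined in the cover. -/
theorem CoverSpace.joined_lift (h : FundamentalGroup S s₀ →* G) {x y : S}
    (δ : Path.Homotopic.Quotient x y) (i : Fin d) :
    Joined (⟨x, i⟩ : CoverSpace h) ⟨y, sheetPerm h δ i⟩ := by
  induction δ with
  | mk δ =>
    refine ⟨⟨⟨_, CoverSpace.continuous_lift h δ i⟩, ?_, ?_⟩⟩
    · ext1
      · exact δ.source
      · have : ∀ (z : S) (e : Path z z), e = Path.refl z →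
            sheetPerm h (Path.Homotopic.Quotient.mk e) i = i := by
          rintro z _ rfl
          rw [Path.Homotopic.Quotient.mk_refl, sheetPerm_refl]; rfl
        exact this _ _ (Path.subpath_self δ 0)
    · ext1
      · exact δ.target
      · have : ∀ {x' y' : S} (hx : x' = x) (hy : y' = y),
            sheetPerm h (Path.Homotopic.Quotient.mk (δ.cast hx hy)) i =
              sheetPerm h (Path.Homotopic.Quotient.mk δ) i := by
          rintro _ _ rfl rfl; rfl
        change sheetPerm h (Path.Homotopic.Quotient.mk (δ.subpath 0 1)) i = _
        rw [Path.subpath_zero_one]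
        exact this _ _

/-- A cover with transitive monodromy is connected. -/
theorem CoverSpace.connectedSpace (h : FundamentalGroup S s₀ →* G)
    (i₀ : Fin d) (ht : ∀ i, ∃ γ, (h γ : Equiv.Perm (Fin d)) i₀ = i) :
    ConnectedSpace (CoverSpace h) := by
  have key : ∀ z : CoverSpace h, Joined (⟨s₀, i₀⟩ : CoverSpace h) z := by
    rintro ⟨x, j⟩
    obtain ⟨γ, hγ⟩ := ht ((sheetPerm h (basePath s₀ x)).symm j)
    have h1 := CoverSpace.joined_lift h (FundamentalGroup.toPath γ) i₀
    rw [sheetPerm_loop, hγ] at h1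
    have h2 := CoverSpace.joined_lift h (basePath s₀ x) ((sheetPerm h (basePath s₀ x)).symm j)
    rw [Equiv.apply_symm_apply] at h2
    exact h1.trans h2
  have : PathConnectedSpace (CoverSpace h) :=
    { nonempty := ⟨⟨s₀, i₀⟩⟩, joined := fun x y => (key x).symm.trans (key y) }
  infer_instance

/-- A continuous map of the base lifts to a map of covers that permutes the sheets by `P`, if `P`
is compatible with the monodromies. -/
theorem CoverSpace.continuous_map {h h' : FundamentalGroup S s₀ →* G} (φ : C(S, S))
    (P : S → Equiv.Perm (Fin d))
    (hP : ∀ {x y : S} (δ : Path.Homotopic.Quotient x y) (i : Fin d),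
      P y (sheetPerm h δ i) = sheetPerm h' (δ.map φ) (P x i)) :
    Continuous fun z : CoverSpace h => (⟨φ z.pt, P z.pt z.sheet⟩ : CoverSpace h') := by
  refine ⟨fun U hU => ?_⟩
  rw [CoverSpace.isOpen_iff]
  intro z hz
  obtain ⟨V, hV, hzV, h1⟩ := CoverSpace.isOpen_iff.1 hU _ hz
  refine ⟨φ ⁻¹' V, hV.preimage φ.continuous, hzV, fun y δ hδ => ?_⟩
  have := h1 _ (δ.map φ.continuous) fun t => hδ t
  rw [mem_preimage]
  simp only [hP]
  exact this

theorem sheetPerm_map_of_comp_eq_id (h : FundamentalGroup S s₀ →* G) {f g : C(S, S)}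
    (hgf : g.comp f = ContinuousMap.id S) {x y : S} (δ : Path.Homotopic.Quotient x y) :
    sheetPerm h ((δ.map f).map g) = sheetPerm h δ := by
  rw [← Path.Homotopic.Quotient.map_comp]
  have : ∀ k : C(S, S), k = ContinuousMap.id S → sheetPerm h (δ.map k) = sheetPerm h δ := by
    rintro _ rfl
    induction δ with
    | mk δ => rfl
  exact this _ hgf

theorem sheetPerm_symm (h : FundamentalGroup S s₀ →* G) {x y : S}
    (δ : Path.Homotopic.Quotient x y) : sheetPerm h δ.symm = (sheetPerm h δ)⁻¹ := by
  rw [eq_inv_iff_mul_eq_one, ← sheetPerm_trans, Path.Homotopic.Quotient.trans_symm, sheetPerm_refl]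

/-- A self-homeomorphism that acts on the local coordinates as the matrix `v` transforms the cover
with monodromy `h` into the one whose monodromy is `h` composed with the induced automorphism of the
fundamental group. -/
theorem TranslationStructure.smul_cover_equivalent (T : TranslationStructure S) {v : SL2R}
    (φ : S ≃ₜ S) (hφ : ∀ p, ∀ᶠ q in 𝓝 p, T.coord (φ p) (φ q) = (v • T).coord p q)
    (β : Path.Homotopic.Quotient s₀ (φ s₀)) (h : FundamentalGroup S s₀ →* G) :
    TranslationEquivalent
      (v • T.cover (h.comp (FundamentalGroup.mapAlong (φ : C(S, S)) β))) (T.cover h) := by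
  set θ := FundamentalGroup.mapAlong (φ : C(S, S)) β with hθ
  -- the point on sheet `i` over `x` is the end of the lift of `basePath s₀ x` from sheet `i`; it is
  -- mapped to the end of the lift of `β` followed by the image of `basePath s₀ x`
  let P : S → Equiv.Perm (Fin d) := fun x =>
    sheetPerm h (β.trans ((basePath s₀ x).map (φ : C(S, S))))
  have hP : ∀ {x y : S} (δ : Path.Homotopic.Quotient x y) (i : Fin d),
      P y (sheetPerm (h.comp θ) δ i) = sheetPerm h (δ.map (φ : C(S, S))) (P x i) := by
    intro x y δ i
    have h1 : sheetPerm (h.comp θ) δ = sheetPerm h (FundamentalGroup.toPath (θ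
        (FundamentalGroup.fromPath (((basePath s₀ x).trans δ).trans (basePath s₀ y).symm)))) := by
      rw [sheetPerm_loop]; rfl
    have h2 : FundamentalGroup.toPath (θ
        (FundamentalGroup.fromPath (((basePath s₀ x).trans δ).trans (basePath s₀ y).symm))) =
        (β.trans ((((basePath s₀ x).trans δ).trans (basePath s₀ y).symm).map (φ : C(S, S)))).trans
          β.symm := rfl
    rw [h1, h2]
    simp only [P, Path.Homotopic.Quotient.map_trans, Path.Homotopic.Quotient.map_symm,
      sheetPerm_trans, sheetPerm_symm, ← Equiv.Perm.mul_apply]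
    congr 1
    group
  have hφφ : (φ : C(S, S)).comp (φ.symm : C(S, S)) = ContinuousMap.id S := by ext; simp
  have hQ : ∀ {x y : S} (δ : Path.Homotopic.Quotient x y) (i : Fin d),
      (P (φ.symm y))⁻¹ (sheetPerm h δ i) =
        sheetPerm (h.comp θ) (δ.map (φ.symm : C(S, S))) ((P (φ.symm x))⁻¹ i) := by
    intro x y δ i
    rw [Equiv.Perm.inv_eq_iff_eq]
    have := hP (δ.map (φ.symm : C(S, S))) ((P (φ.symm x))⁻¹ i)
    rw [sheetPerm_map_of_comp_eq_id h hφφ] at this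
    simpa using this.symm
  refine ⟨{ toFun := fun z => ⟨φ z.pt, P z.pt z.sheet⟩
            invFun := fun z => ⟨φ.symm z.pt, (P (φ.symm z.pt))⁻¹ z.sheet⟩
            left_inv := fun z => by ext1 <;> simp
            right_inv := fun z => by ext1 <;> simp
            continuous_toFun := CoverSpace.continuous_map (φ : C(S, S)) P hP
            continuous_invFun := CoverSpace.continuous_map (φ.symm : C(S, S))
              (fun x => (P (φ.symm x))⁻¹) hQ }, fun p => ?_⟩
  exact (CoverSpace.continuous_pt _).continuousAt.eventually (hφ p.pt)

end Covers

/-! ### Recurrence of the trajectory -/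

section Recurrence

/-- If a sequence of cosets converges, then representatives of a subsequence converge. -/
theorem exists_tendsto_mul_of_tendsto_mk {K : Type*} [Group K] [TopologicalSpace K]
    [IsTopologicalGroup K] [FirstCountableTopology K] (V : Subgroup K) {g : ℕ → K} {y : K ⧸ V}
    (hg : Tendsto (fun n => (g n : K ⧸ V)) atTop (𝓝 y)) :
    ∃ (φ : ℕ → ℕ) (v : ℕ → V) (B : K), StrictMono φ ∧
      Tendsto (fun n => g (φ n) * v n) atTop (𝓝 B) := by
  obtain ⟨B, rfl⟩ := QuotientGroup.mk_surjective y
  obtain ⟨U, hU⟩ := (𝓝 B).exists_antitone_basis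
  have h1 : ∀ k, ∀ᶠ n in atTop, ∃ v : V, g n * v ∈ U k := fun k => by
    have := hg ((QuotientGroup.isOpenMap_coe (N := V)).image_mem_nhds (hU.mem k))
    filter_upwards [this] with n hn
    obtain ⟨a, ha, hag⟩ := hn
    exact ⟨⟨_, QuotientGroup.eq.1 hag.symm⟩, by simpa using ha⟩
  obtain ⟨φ, hφ, h2⟩ := extraction_forall_of_eventually h1
  choose v hv using h2
  exact ⟨φ, v, B, hφ, hU.tendsto hv⟩

instance SL2R.firstCountableTopology : FirstCountableTopology SL2R :=
  have : FirstCountableTopology (Matrix (Fin 2) (Fin 2) ℝ) :=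
    inferInstanceAs (FirstCountableTopology (Fin 2 → Fin 2 → ℝ))
  Matrix.SpecialLinearGroup.isClosedEmbedding_val.isInducing.firstCountableTopology

theorem continuous_freeGroupBasis_lift {Γ G ι : Type*} [Group Γ] [Group G]
    (b : FreeGroupBasis ι Γ) :
    letI : TopologicalSpace G := ⊥
    Continuous (fun σ : ι → G => b.lift σ) := by
  let _ : TopologicalSpace G := ⊥
  have : DiscreteTopology G := ⟨rfl⟩
  refine continuous_induced_rng.2 (continuous_pi fun γ => ?_)
  have : γ ∈ Subgroup.closure (range b) := by rw [b.closure_range]; trivial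
  change Continuous fun σ : ι → G => b.lift σ γ
  induction this using Subgroup.closure_induction with
  | mem g hg => obtain ⟨i, rfl⟩ := hg; simpa using continuous_apply i
  | one => simpa using continuous_const
  | mul x y _ _ hx hy =>
    simp only [map_mul]
    exact (continuous_of_discreteTopology (f := fun g : G × G => g.1 * g.2)).comp (hx.prodMk hy)
  | inv x _ hx =>
    simp only [map_inv]
    exact (continuous_of_discreteTopology (f := fun g : G => g⁻¹)).comp hx

theorem InfiniteTopologicalType.infinite {S : Type*} [TopologicalSpace S]
    (hS : InfiniteTopologicalType S) {s₀ : S} {ι : Type*}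
    (b : FreeGroupBasis ι (FundamentalGroup S s₀)) : Infinite ι := by
  by_contra h
  rw [not_infinite_iff_finite] at h
  exact hS s₀ ((Group.fg_iff).2 ⟨range b, b.closure_range, finite_range b⟩)

namespace TranslationStructure

variable {S : Type*} [TopologicalSpace S] [PathConnectedSpace S] (T : TranslationStructure S)
  {s₀ : S} {d : ℕ} {G : Subgroup (Equiv.Perm (Fin d))}

theorem continuous_deformedCov_mk : Continuous fun x : SL2R × (FundamentalGroup S s₀ →* G) =>
    DeformedCov.mk T x.1 (Cov.mk T s₀ G x.2) := by
  have h1 : Continuous (Cov.mk T s₀ G) := continuous_quot_mk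
  have h2 : Continuous fun u : SL2R × T.Cov s₀ G => DeformedCov.mk T u.1 u.2 := continuous_quot_mk
  exact h2.comp (continuous_fst.prodMk (h1.comp continuous_snd))

/-- Replacing `A` by `A v`, where `v` is in the Veech group, amounts to composing the monodromy with
the automorphism of the fundamental group that `v` induces. -/
theorem exists_automorphism_of_mem_veechGroup {v : SL2R} (hv : v ∈ T.veechGroup) :
    ∃ θ : FundamentalGroup S s₀ ≃* FundamentalGroup S s₀,
      ∀ (A : SL2R) (h : FundamentalGroup S s₀ →* G),
        DeformedCov.mk T A (Cov.mk T s₀ G h) =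
          DeformedCov.mk T (A * v) (Cov.mk T s₀ G (h.comp θ.toMonoidHom)) := by
  obtain ⟨φ, hφ⟩ := hv
  let β := Path.Homotopic.Quotient.mk (PathConnectedSpace.somePath s₀ (φ s₀))
  refine ⟨MulEquiv.ofBijective _ (FundamentalGroup.bijective_mapAlong φ β), fun A h => ?_⟩
  exact Quotient.sound ⟨h, _, rfl, rfl,
    ((mul_smul_equiv A v _).trans ((T.smul_cover_equivalent φ hφ β h).smul A)).symm⟩

/-- If the matrices `g^{t_n} v_n` converge, with `v_n` in the Veech group, and if the monodromies
transported by the `v_n` are surjective, infinitely often already on a fixed finite set of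
generators, then the trajectory of the cover has a connected accumulation point. -/
theorem hasConnectedAccumulationPoint_of_frequently [Nonempty (Fin d)]
    (hG : MulAction.IsPretransitive G (Fin d)) {ι : Type*} [Countable ι]
    (b : FreeGroupBasis ι (FundamentalGroup S s₀)) {t : ℕ → ℝ} (ht : Tendsto t atTop atTop)
    {v : ℕ → SL2R} {B : SL2R} (hB : Tendsto (fun n => SL2R.teich (t n) * v n) atTop (𝓝 B))
    {θ : ℕ → FundamentalGroup S s₀ ≃* FundamentalGroup S s₀} {h : FundamentalGroup S s₀ →* G}
    (hθ : ∀ n, DeformedCov.mk T (SL2R.teich (t n)) (Cov.mk T s₀ G h) =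
      DeformedCov.mk T (SL2R.teich (t n) * v n) (Cov.mk T s₀ G (h.comp (θ n).toMonoidHom)))
    {s : Finset ι} (hs : ∃ᶠ n in atTop, ∀ g, ∃ i ∈ s, h (θ n (b i)) = g) :
    Cov.HasConnectedAccumulationPoint T (Cov.mk T s₀ G h) := by
  let _ : TopologicalSpace G := ⊥
  have : DiscreteTopology G := ⟨rfl⟩
  obtain ⟨ψ, hψ, hψs⟩ := extraction_of_frequently_atTop hs
  -- the transported monodromies converge along a subsequence, because `ι → G` is compact
  let σ : ℕ → ι → G := fun k i => h (θ (ψ k) (b i))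
  obtain ⟨τ, ψ', hψ', hτ⟩ := CompactSpace.tendsto_subseq σ
  have hψψ : Tendsto (fun k => ψ (ψ' k)) atTop atTop :=
    hψ.tendsto_atTop.comp hψ'.tendsto_atTop
  have hlift : ∀ k, b.lift (σ k) = h.comp (θ (ψ k)).toMonoidHom := fun k =>
    b.ext_hom _ _ fun i => by simp [σ]
  have hlim : Tendsto (fun k => h.comp (θ (ψ (ψ' k))).toMonoidHom) atTop (𝓝 (b.lift τ)) := by
    have := ((continuous_freeGroupBasis_lift (G := G) b).tendsto τ).comp hτ
    refine this.congr fun k => ?_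
    exact hlift _
  have hτs : ∀ g, ∃ i ∈ s, τ i = g := by
    have h1 : ∀ᶠ k in atTop, ∀ i ∈ s, σ (ψ' k) i = τ i := by
      rw [Finset.eventually_all]
      intro i _
      have := (tendsto_pi_nhds.1 hτ i)
      rw [nhds_discrete, tendsto_pure] at this
      exact this
    obtain ⟨k, hk⟩ := h1.exists
    intro g
    obtain ⟨i, hi, hig⟩ := hψs (ψ' k) g
    exact ⟨i, hi, (hk i hi).symm.trans hig⟩
  refine ⟨fun k => t (ψ (ψ' k)), DeformedCov.mk T B (Cov.mk T s₀ G (b.lift τ)),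
    ht.comp hψψ, ?_, B, b.lift τ, rfl, ?_⟩
  · simp only [hθ]
    exact (T.continuous_deformedCov_mk.tendsto (B, b.lift τ)).comp
      ((hB.comp hψψ).prodMk_nhds hlim)
  · obtain ⟨i₀⟩ := ‹Nonempty (Fin d)›
    refine CoverSpace.connectedSpace _ i₀ fun i => ?_
    obtain ⟨g, hg⟩ := hG.exists_smul_eq i₀ i
    obtain ⟨j, -, hj⟩ := hτs g
    have hbj : b.lift τ (b j) = g := by simpa using hj
    exact ⟨b j, by rw [hbj]; exact hg⟩

end TranslationStructure

end Recurrence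

theorem theorem2 {S : Type*} [TopologicalSpace S] [T2Space S] [SecondCountableTopology S]
    [PathConnectedSpace S] (T : TranslationStructure S)
    (hArea : T.FiniteArea) (hType : InfiniteTopologicalType S) (hNonDiv : T.NonDivergent)
    {d : ℕ} (hd : 2 ≤ d) (G : Subgroup (Equiv.Perm (Fin d)))
    (hG : MulAction.IsPretransitive G (Fin d))
    (s₀ : S) {ι : Type*} [Countable ι] (b : FreeGroupBasis ι (FundamentalGroup S s₀)) :
    ∀ᵐ x ∂(T.covMeasure G b),
      TranslationStructure.Cov.HasConnectedAccumulationPoint T x := by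
  have : Infinite ι := hType.infinite b
  have : Nonempty (Fin d) := ⟨⟨0, by omega⟩⟩
  obtain ⟨t, y, ht, hy⟩ := hNonDiv
  obtain ⟨φ, v, B, hφ, hB⟩ := exists_tendsto_mul_of_tendsto_mk _ hy
  choose θ hθ using fun n =>
    T.exists_automorphism_of_mem_veechGroup (s₀ := s₀) (G := G) (v n).2
  have hae : ∀ᵐ h ∂(productMeasure b G),
      TranslationStructure.Cov.HasConnectedAccumulationPoint T
        (TranslationStructure.Cov.mk T s₀ G h) := by
    filter_upwards [ae_exists_frequently_surjOn (G := G) b fun n => b.map (θ n)] with h hh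
    obtain ⟨s, hs⟩ := hh
    exact T.hasConnectedAccumulationPoint_of_frequently hG b (ht.comp hφ.tendsto_atTop) hB
      (fun n => hθ n _ h) (s := s) (by simpa using hs)
  rw [ae_iff] at hae ⊢
  -- the exceptional set need not be a Borel set, but it is measurable for the completed measure
  exact (T.covMeasure_apply G b
    (B := {x | ¬ TranslationStructure.Cov.HasConnectedAccumulationPoint T x})
    (NullMeasurableSet.of_null hae)).trans hae
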